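/- Let $d\ge 1$, $r=(r_1,\dots,r_d)$ with integers $r_i\ge 1$, and $h=h(n)=2^{-n}$ for $n\in\mathbb N$. Let $\chi(t)=\max(0,1-|t|)$. For $m\in\mathbb Z^d$ let $I(m)=\{k\in\mathbb Z^d: k_i\equiv m_i \pmod{r_i},\ i=1,\dots,d\}$ be the index set of the subgrid with base knot $hm$ and spacings $hr_i$, and put $\psi_k(x)=\prod_{i=1}^d\chi\big((x_i-hk_i)/(hr_i)\big)$. For $u\in L_2(\mathbb R^d)$ (real-valued) let $$\hat u(n)=\sum_{k\in I(m)}\|\psi_k\|_1^{-1}\,(\psi_k|u)\,\psi_k ,$$ where $(\cdot|\cdot)$ is the scalar product and $\|\cdot\|_2$ the norm of $L_2(\mathbb R^d)$. Write $\partial u=(\partial_1u,\dots,\partial_du)$ for the weak gradient, $(V|U)=\sum_i(V_i|U_i)$ and $\|U\|_2^2=\sum_i\|U_i\|_2^2$ for vector fields, $\Gamma_2(w,u)=\|u(\cdot+w)-u\|_2$ for $w\in\mathbb R^d$ (and likewise for vector fields), $|w|$ for the Euclidean norm, and $(D_tu)_i(x)=t_i^{-1}\big(u(x+t_ie_i)-u(x)\big)$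 for the forward difference quotients with steps $t=(t_1,\dots,t_d)$. There is a constant $c=c(d,r)>0$ such that for all $n\in\mathbb N$, all $m\in\mathbb Z^d$ and all $v,u\in W_2^1(\mathbb R^d)$ the functions $\hat v(n),\hat u(n)$ belong to $W_2^1(\mathbb R^d)$ and: (a) $$\big|(\hat v(n)|\hat u(n))-(v|u)\big|\le c\,\min\Big\{\|u\|_2\sup_{|w|=h}\Gamma_2(w,v),\ \|v\|_2\sup_{|w|=h}\Gamma_2(w,u)\Big\}\quad\text{if } d\ge 2,$$ and for every $d\ge 1$ the same holds with both suprema taken over $|w|\le h$ instead of $|w|=h$; (b) for every $d\ge1$, both for the steps $t_i=hr_i$ and for the steps $t_i=h$, $$\big|(\partial\hat v(n)|\partial\hat u(n))-(\partial v|\partial u)\big|\le c\,\min\Big\{\|\partial v\|_2\Big[\|\partial u-D_tu\|_2+\sup_{|w|=h}\Gamma_2(w,\partial u)\Big],\ \|\partial u\|_2\Big[\|\partial v-D_tv\|_2+\sup_{|w|=h}\Gamma_2(w,\partial v)\Big]\Big\}.$$ -/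

import Mathlib

open MeasureTheory
open scoped ContDiff

namespace HatFE

/-- The Euclidean space `ℝ^d`. -/
abbrev Space (d : ℕ) : Type := EuclideanSpace ℝ (Fin d)

/-- `g` is the weak `i`-th partial derivative of `u` (tested against smooth functions with compact
support). -/
def HasWeakPartial {d : ℕ} (i : Fin d) (u g : Space d → ℝ) : Prop :=
  ∀ φ : Space d → ℝ, ContDiff ℝ ∞ φ → HasCompactSupport φ →
    ∫ x, u x * fderiv ℝ φ x (EuclideanSpace.single i 1) = - ∫ x, g x * φ x

/-- The Sobolev space `W_2^1(ℝ^d)`: real functions in `L_2` whose weak partial derivatives exist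
and belong to `L_2`. -/
def MemW12 {d : ℕ} (u : Space d → ℝ) : Prop :=
  MemLp u 2 volume ∧ ∀ i : Fin d, ∃ g : Space d → ℝ, MemLp g 2 volume ∧ HasWeakPartial i u g

open Classical in
/-- The weak gradient: `weakGrad u i` is (a representative of) the weak partial derivative
`∂_i u ∈ L_2`, and it is `0` if there is none. -/
noncomputable def weakGrad {d : ℕ} (u : Space d → ℝ) (i : Fin d) : Space d → ℝ :=
  if h : ∃ g : Space d → ℝ, MemLp g 2 volume ∧ HasWeakPartial i u g then h.choose else 0

theorem weakGrad_spec {d : ℕ} {u : Space d → ℝ} (hu : MemW12 u) (i : Fin d) :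
    MemLp (weakGrad u i) 2 volume ∧ HasWeakPartial i u (weakGrad u i) := by
  unfold weakGrad
  rw [dif_pos (hu.2 i)]
  exact (hu.2 i).choose_spec

/-- The scalar product `(v | u)` of `L_2(ℝ^d)`. -/
noncomputable def ip {d : ℕ} (v u : Space d → ℝ) : ℝ := ∫ x, v x * u x

/-- The scalar product `(V | U) = ∑_i (V_i | U_i)` of `L_2` vector fields. -/
noncomputable def vecIp {d : ℕ} (V U : Fin d → Space d → ℝ) : ℝ := ∑ i, ip (V i) (U i)

/-- The norm `‖u‖_2` of `L_2(ℝ^d)`. -/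
noncomputable def norm2 {d : ℕ} (u : Space d → ℝ) : ℝ := lpNorm u 2 volume

/-- The norm `‖U‖_2 = (∑_i ‖U_i‖_2^2)^{1/2}` of `L_2` vector fields. -/
noncomputable def vecNorm2 {d : ℕ} (U : Fin d → Space d → ℝ) : ℝ :=
  Real.sqrt (∑ i, norm2 (U i) ^ 2)

/-- The shift operator, `(Z(w) u)(x) = u(x + w)`. -/
def shift {d : ℕ} (w : Space d) (u : Space d → ℝ) : Space d → ℝ := fun x => u (x + w)

/-- `Γ_2(w, u) = ‖(Z(w) - I) u‖_2`. -/
noncomputable def Gam {d : ℕ} (w : Space d) (u : Space d → ℝ) : ℝ := norm2 (shift w u - u)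

/-- `Γ_2(w, U) = ‖(Z(w) - I) U‖_2` for a vector field `U`. -/
noncomputable def vecGam {d : ℕ} (w : Space d) (U : Fin d → Space d → ℝ) : ℝ :=
  vecNorm2 (fun i => shift w (U i) - U i)

/-- The vector of forward difference quotients of `u`, with step `t i` in direction `i`. -/
noncomputable def finDiff {d : ℕ} (t : Fin d → ℝ) (u : Space d → ℝ) (i : Fin d) : Space d → ℝ :=
  fun x => (t i)⁻¹ * (u (x + EuclideanSpace.single i (t i)) - u x)

/-- The grid step `h(n) = 2^{-n}`. -/
noncomputable def step (n : ℕ) : ℝ := (2 ^ n)⁻¹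

/-- The canonical hat function on `ℝ`, centered at `0`, with support `[-1, 1]`. -/
noncomputable def chi (t : ℝ) : ℝ := max 0 (1 - |t|)

/-- The hat function `ψ_k(x) = ∏_i χ((x_i - h k_i) / (h r_i))`. -/
noncomputable def psi {d : ℕ} (r : Fin d → ℕ) (h : ℝ) (k : Fin d → ℤ) : Space d → ℝ :=
  fun x => ∏ i, chi ((x i - h * k i) / (h * r i))

/-- The index set of the subgrid `{r₀ + h ∑ l_i r_i e_i : l_i ∈ ℤ}` with base knot `r₀ = h m`. -/
def subgridIndex {d : ℕ} (r : Fin d → ℕ) (m : Fin d → ℤ) : Set (Fin d → ℤ) :=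
  {k | ∃ l : Fin d → ℤ, ∀ i, k i = m i + l i * r i}

/-- `û(n) = ∑_k ‖ψ_k‖_1⁻¹ (ψ_k | u) ψ_k`, `k` running through the index set of the subgrid, where
`h = h(n)`. At each point only finitely many terms are nonzero. -/
noncomputable def hatApprox {d : ℕ} (r : Fin d → ℕ) (m : Fin d → ℤ) (n : ℕ)
    (u : Space d → ℝ) : Space d → ℝ :=
  fun x => ∑' k : subgridIndex r m,
    (lpNorm (psi r (step n) k) 1 volume)⁻¹ * ip (psi r (step n) k) u * psi r (step n) k x

end HatFE

open HatFE

/-! Everything rests on averaging operators given by couplings. Let `Λ` be a measure on pairs `(x,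
y)` with both marginals Lebesgue, and let `F` be given by `(F | φ) = ∫ f(y) φ(x) dΛ`. By
Cauchy–Schwarz `f ↦ F` is a contraction of `L²`. If `F`, `G` are the images of `f`, `g`, then `|(F |
G) - (f | g)| ≤ 2 ‖f‖ osc(g)`, where `osc(g)` is the `L²(Λ)` norm of `g(y) - g(x)`
(`IsCoupling.abs_ip_sub_ip_le`). The roles of `f` and `g` can be exchanged, which yields the
minimum.

The map `u ↦ û` is such an operator, with `Λ = ∑_l N⁻¹ ψ_l(x) ψ_l(y) dx dy`. The marginals are right
because the `ψ_l` form a partition of unity with common integral `N`. Since this density is at most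
`N⁻¹` and vanishes for distant `x, y`, `osc` is bounded by translations of length comparable to `h`
(`osc_gridMeasure_le`), and these are chains of translations of length at most `h`. This gives the
`L²` estimates.

For gradients, summation by parts shows that `∂_i û` arises from `∂_i u` by two averagings.
Averaging `∂_i u` over segments of length `h r_i` gives the difference quotient `D_i u`
(`represents_finDiff`). A grid operator whose outer functions have a box in place of the `i`-th hat
factor then gives `∂_i û` (`hasWeakPartial_gridOp`). The scalar product estimate is applied to each
averaging.

It remains to pass from `|w| ≤ h` to `|w| = h`. For `d ≥ 2` a vector of the ball is a sum of two
vectors of the sphere. For `d = 1` this fails; there the difference quotient helps, since it changes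
little under short translations and its distance to `∂u` is part of the bound (`Gam_single_le`). -/

namespace HatFE

/-! ### Square integrable functions on a measure space -/

section LTwo

variable {α : Type*} [MeasurableSpace α] {μ : Measure α}

theorem abs_integral_mul_le_lpNorm {f g : α → ℝ} (hf : MemLp f 2 μ) (hg : MemLp g 2 μ) :
    |∫ x, f x * g x ∂μ| ≤ lpNorm f 2 μ * lpNorm g 2 μ := by
  have h := abs_real_inner_le_norm (hg.toLp g) (hf.toLp f)
  rw [L2.inner_def, Lp.norm_toLp, Lp.norm_toLp, toReal_eLpNorm hf.1, toReal_eLpNorm hg.1,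
    mul_comm] at h
  refine le_of_eq_of_le (congrArg _ (integral_congr_ae ?_)) h
  filter_upwards [hf.coeFn_toLp, hg.coeFn_toLp] with x h1 h2
  simp [h1, h2]

theorem integrable_mul_of_memLp_two {f g : α → ℝ} (hf : MemLp f 2 μ) (hg : MemLp g 2 μ) :
    Integrable (fun x => f x * g x) μ := hf.integrable_mul hg

theorem integral_mul_self_eq_lpNorm_sq {f : α → ℝ} (hf : MemLp f 2 μ) :
    ∫ x, f x * f x ∂μ = lpNorm f 2 μ ^ 2 := by
  have h := real_inner_self_eq_norm_sq (hf.toLp f)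
  rw [L2.inner_def, Lp.norm_toLp, toReal_eLpNorm hf.1] at h
  rw [← h]
  refine integral_congr_ae ?_
  filter_upwards [hf.coeFn_toLp] with x h1
  simp [h1, sq]

theorem lpNorm_comp_measurePreserving {β : Type*} [MeasurableSpace β] {ν : Measure β} {f : β → ℝ}
    {p : α → β} (hf : MemLp f 2 ν) (hp : MeasurePreserving p μ ν) :
    lpNorm (fun x => f (p x)) 2 μ = lpNorm f 2 ν := by
  rw [← toReal_eLpNorm hf.1, ← eLpNorm_comp_measurePreserving hf.1 hp]
  exact (toReal_eLpNorm (hf.comp_measurePreserving hp).1).symm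

/-- An `L²` bound on the norm from a bound on the lower integral of the square. -/
theorem lpNorm_two_le_of_lintegral_sq_le {f : α → ℝ} (hf : AEStronglyMeasurable f μ) {C : ℝ}
    (hC : 0 ≤ C) (h : ∫⁻ x, ‖f x‖ₑ ^ 2 ∂μ ≤ ENNReal.ofReal (C ^ 2)) : lpNorm f 2 μ ≤ C := by
  rw [← toReal_eLpNorm hf]
  refine ENNReal.toReal_le_of_le_ofReal hC ?_
  rw [eLpNorm_eq_lintegral_rpow_enorm_toReal (by norm_num) (by norm_num)]
  simp only [ENNReal.toReal_ofNat, ENNReal.rpow_ofNat]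
  calc _ ≤ (ENNReal.ofReal (C ^ 2)) ^ (1 / 2 : ℝ) := by gcongr
    _ = ENNReal.ofReal C := by
      rw [ENNReal.ofReal_rpow_of_nonneg (by positivity) (by norm_num), ← Real.sqrt_eq_rpow,
        Real.sqrt_sq hC]

theorem lintegral_sq_le_of_lpNorm_two_le {f : α → ℝ} (hf : MemLp f 2 μ) {C : ℝ}
    (h : lpNorm f 2 μ ≤ C) : ∫⁻ x, ‖f x‖ₑ ^ 2 ∂μ ≤ ENNReal.ofReal (C ^ 2) := by
  have h1 : eLpNorm f 2 μ ≤ ENNReal.ofReal C := by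
    rw [← ofReal_lpNorm hf]; exact ENNReal.ofReal_le_ofReal h
  rw [eLpNorm_eq_lintegral_rpow_enorm_toReal (by norm_num) (by norm_num)] at h1
  simp only [ENNReal.toReal_ofNat, ENNReal.rpow_ofNat] at h1
  have h2 := ENNReal.rpow_le_rpow h1 (show (0 : ℝ) ≤ 2 by norm_num)
  rw [← ENNReal.rpow_mul] at h2
  norm_num at h2
  rwa [← ENNReal.ofReal_pow (lpNorm_nonneg.trans h)] at h2

end LTwo

/-! ### Couplings and their averaging operators -/

variable {d : ℕ}

theorem ip_comm (v u : Space d → ℝ) : ip v u = ip u v := by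
  simp only [ip, mul_comm]

theorem norm2_nonneg (u : Space d → ℝ) : 0 ≤ norm2 u := lpNorm_nonneg

/-- A measure on `ℝ^d × ℝ^d` both of whose marginals are Lebesgue measure. -/
structure IsCoupling (Λ : Measure (Space d × Space d)) : Prop where
  fst : MeasurePreserving Prod.fst Λ volume
  snd : MeasurePreserving Prod.snd Λ volume

/-- `F` is the image of `f` under the averaging operator associated with `Λ`. -/
def Represents (Λ : Measure (Space d × Space d)) (f F : Space d → ℝ) : Prop :=
  MemLp F 2 volume ∧ ∀ φ : Space d → ℝ, MemLp φ 2 volume →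
    ip F φ = ∫ p, f p.2 * φ p.1 ∂Λ

/-- The mean square oscillation of `f` with respect to `Λ`. -/
noncomputable def osc (Λ : Measure (Space d × Space d)) (f : Space d → ℝ) : ℝ :=
  lpNorm (fun p => f p.2 - f p.1) 2 Λ

theorem memLp_of_test {φ : Space d → ℝ} (hφ : ContDiff ℝ ∞ φ)
    (hc : HasCompactSupport φ) : MemLp φ 2 volume :=
  hφ.continuous.memLp_of_hasCompactSupport hc

theorem ae_eq_of_test {f g : Space d → ℝ} (hf : LocallyIntegrable f)
    (hg : LocallyIntegrable g) (h : ∀ φ : Space d → ℝ, ContDiff ℝ ∞ φ → HasCompactSupport φ →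
      ip f φ = ip g φ) : f =ᵐ[volume] g := by
  refine ae_eq_of_integral_contDiff_smul_eq hf hg fun φ h1 h2 => ?_
  have := h φ h1 h2
  simpa only [ip, smul_eq_mul, mul_comm] using this

namespace IsCoupling

variable {Λ : Measure (Space d × Space d)}

theorem memLp_fst (hΛ : IsCoupling Λ) {f : Space d → ℝ} (hf : MemLp f 2 volume) :
    MemLp (fun p => f p.1) 2 Λ := hf.comp_measurePreserving hΛ.fst

theorem memLp_snd (hΛ : IsCoupling Λ) {f : Space d → ℝ} (hf : MemLp f 2 volume) :
    MemLp (fun p => f p.2) 2 Λ := hf.comp_measurePreserving hΛ.snd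

theorem integrable_pairing (hΛ : IsCoupling Λ) {f φ : Space d → ℝ} (hf : MemLp f 2 volume)
    (hφ : MemLp φ 2 volume) : Integrable (fun p => f p.2 * φ p.1) Λ :=
  integrable_mul_of_memLp_two (hΛ.memLp_snd hf) (hΛ.memLp_fst hφ)

theorem abs_pairing_le (hΛ : IsCoupling Λ) {f φ : Space d → ℝ} (hf : MemLp f 2 volume)
    (hφ : MemLp φ 2 volume) : |∫ p, f p.2 * φ p.1 ∂Λ| ≤ norm2 f * norm2 φ := by
  have h := abs_integral_mul_le_lpNorm (hΛ.memLp_snd hf) (hΛ.memLp_fst hφ)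
  rwa [lpNorm_comp_measurePreserving hf hΛ.snd, lpNorm_comp_measurePreserving hφ hΛ.fst] at h

/-- The first marginal turns `(f | φ)` into `∫ f(x) φ(x) dΛ`, so the difference pairs `f(y) - f(x)`
with `φ(x)`. The primed version uses the second marginal and puts the oscillation on `φ`. -/
theorem abs_pairing_sub_ip_le (hΛ : IsCoupling Λ) {f φ : Space d → ℝ} (hf : MemLp f 2 volume)
    (hφ : MemLp φ 2 volume) :
    |∫ p, f p.2 * φ p.1 ∂Λ - ip f φ| ≤ osc Λ f * norm2 φ := by
  have h1 : ip f φ = ∫ p, f p.1 * φ p.1 ∂Λ := by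
    have := hΛ.fst.map_eq
    rw [ip]
    nth_rewrite 1 [← this]
    refine integral_map hΛ.fst.measurable.aemeasurable ?_
    rw [this]; exact hf.1.mul hφ.1
  rw [h1, ← integral_sub (hΛ.integrable_pairing hf hφ)
    (integrable_mul_of_memLp_two (hΛ.memLp_fst hf) (hΛ.memLp_fst hφ))]
  have h := abs_integral_mul_le_lpNorm ((hΛ.memLp_snd hf).sub (hΛ.memLp_fst hf)) (hΛ.memLp_fst hφ)
  rw [lpNorm_comp_measurePreserving hφ hΛ.fst] at h
  simp only [← sub_mul]
  exact h

theorem abs_pairing_sub_ip_le' (hΛ : IsCoupling Λ) {f φ : Space d → ℝ} (hf : MemLp f 2 volume)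
    (hφ : MemLp φ 2 volume) :
    |∫ p, f p.2 * φ p.1 ∂Λ - ip f φ| ≤ norm2 f * osc Λ φ := by
  have h1 : ip f φ = ∫ p, f p.2 * φ p.2 ∂Λ := by
    have := hΛ.snd.map_eq
    rw [ip]
    nth_rewrite 1 [← this]
    refine integral_map hΛ.snd.measurable.aemeasurable ?_
    rw [this]; exact hf.1.mul hφ.1
  rw [h1, ← integral_sub (hΛ.integrable_pairing hf hφ)
    (integrable_mul_of_memLp_two (hΛ.memLp_snd hf) (hΛ.memLp_snd hφ))]
  have h := abs_integral_mul_le_lpNorm (hΛ.memLp_snd hf) ((hΛ.memLp_fst hφ).sub (hΛ.memLp_snd hφ))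
  rw [lpNorm_comp_measurePreserving hf hΛ.snd, lpNorm_sub_comm] at h
  simp only [← mul_sub]
  exact h

/-- Testing with `F` itself gives `‖F‖² ≤ ‖f‖ ‖F‖`. -/
theorem norm2_le_of_represents (hΛ : IsCoupling Λ) {f F : Space d → ℝ} (hf : MemLp f 2 volume)
    (hF : Represents Λ f F) : norm2 F ≤ norm2 f := by
  have h := hΛ.abs_pairing_le hf hF.1
  rw [← hF.2 F hF.1, ip, integral_mul_self_eq_lpNorm_sq hF.1, abs_of_nonneg (by positivity)] at h
  change norm2 F ^ 2 ≤ _ at h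
  by_contra hlt
  push Not at hlt
  nlinarith [norm2_nonneg f]

/-- Averaging operators almost preserve the scalar product. -/
theorem abs_ip_sub_ip_le (hΛ : IsCoupling Λ) {f g F G : Space d → ℝ} (hf : MemLp f 2 volume)
    (hg : MemLp g 2 volume) (hF : Represents Λ f F) (hG : Represents Λ g G) :
    |ip F G - ip f g| ≤ 2 * (norm2 f * osc Λ g) := by
  -- The comparison passes through `(F | g)`. Replacing `G` by `g` and then `F` by `f` are both paid
  -- for by the oscillation of `g`, so no regularity of `f` enters.
  have h1 := hΛ.abs_pairing_sub_ip_le hg hF.1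
  rw [← hG.2 F hF.1] at h1
  have h2 := hΛ.abs_pairing_sub_ip_le' hf hg
  rw [← hF.2 g hg] at h2
  rw [ip_comm G F, ip_comm g F] at h1
  have h3 : osc Λ g * norm2 F ≤ norm2 f * osc Λ g := by
    rw [mul_comm]
    exact mul_le_mul_of_nonneg_right (hΛ.norm2_le_of_represents hf hF) lpNorm_nonneg
  have := abs_add_le (ip F G - ip F g) (ip F g - ip f g)
  rw [sub_add_sub_cancel] at this
  linarith

/-- Composition with the first projection is an isometry into `L²(Λ)`; its adjoint, applied to
`f(y)`, is the required function. -/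
theorem exists_represents (hΛ : IsCoupling Λ) {f : Space d → ℝ} (hf : MemLp f 2 volume) :
    ∃ F, Represents Λ f F := by
  obtain ⟨T, hT⟩ : ∃ T : Lp ℝ 2 (volume : Measure (Space d)) →L[ℝ] Lp ℝ 2 Λ,
      ∀ (φ : Space d → ℝ) (hφ : MemLp φ 2 volume), T (hφ.toLp φ) = (hΛ.memLp_fst hφ).toLp _ :=
    ⟨(Lp.compMeasurePreservingₗᵢ ℝ (E := ℝ) (p := 2) Prod.fst hΛ.fst).toContinuousLinearMap,
      fun φ hφ => Lp.toLp_compMeasurePreserving hφ hΛ.fst⟩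
  obtain ⟨F, hF⟩ : ∃ F : Lp ℝ 2 (volume : Measure (Space d)),
      ∀ y, inner ℝ F y = inner ℝ ((hΛ.memLp_snd hf).toLp _) (T y) :=
    ⟨ContinuousLinearMap.adjoint T ((hΛ.memLp_snd hf).toLp _), fun y =>
      ContinuousLinearMap.adjoint_inner_left T y _⟩
  refine ⟨F, Lp.memLp F, fun φ hφ => ?_⟩
  have h := hF (hφ.toLp φ)
  rw [hT, L2.inner_def, L2.inner_def] at h
  refine Eq.trans (integral_congr_ae ?_) (h.trans (integral_congr_ae ?_))
  · filter_upwards [hφ.coeFn_toLp] with x hx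
    rw [hx, Real.inner_apply, mul_comm]
  · filter_upwards [(hΛ.memLp_fst hφ).coeFn_toLp, (hΛ.memLp_snd hf).coeFn_toLp] with x hx hx'
    rw [hx, hx', Real.inner_apply, mul_comm]

/-- For explicit formulas it suffices to check smooth test functions: the candidate then agrees
almost everywhere with the abstract image, which supplies square integrability and all other `φ`. -/
theorem represents_of_test (hΛ : IsCoupling Λ) {f F : Space d → ℝ} (hf : MemLp f 2 volume)
    (hF : LocallyIntegrable F) (h : ∀ φ : Space d → ℝ, ContDiff ℝ ∞ φ → HasCompactSupport φ →
      ip F φ = ∫ p, f p.2 * φ p.1 ∂Λ) : Represents Λ f F := by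
  obtain ⟨G, hG⟩ := hΛ.exists_represents hf
  have hFG : F =ᵐ[volume] G := ae_eq_of_test hF (hG.1.locallyIntegrable (by norm_num))
    fun φ h1 h2 => (h φ h1 h2).trans (hG.2 φ (memLp_of_test h1 h2)).symm
  refine ⟨(memLp_congr_ae hFG).2 hG.1, fun φ hφ => ?_⟩
  rw [← hG.2 φ hφ]
  refine integral_congr_ae ?_
  filter_upwards [hFG] with x hx
  rw [hx]

end IsCoupling

/-! ### Translations in `L²` -/

section Shift

theorem measurePreserving_add_const (w : Space d) :
    MeasurePreserving (fun x : Space d => x + w) volume volume := measurePreserving_add_right _ w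

theorem memLp_shift {u : Space d → ℝ} (hu : MemLp u 2 volume) (w : Space d) :
    MemLp (shift w u) 2 volume := hu.comp_measurePreserving (measurePreserving_add_const w)

theorem norm2_shift {u : Space d → ℝ} (hu : MemLp u 2 volume) (w : Space d) :
    norm2 (shift w u) = norm2 u :=
  lpNorm_comp_measurePreserving hu (measurePreserving_add_const w)

theorem norm2_add_le {u v : Space d → ℝ} (hu : MemLp u 2 volume) :
    norm2 (u + v) ≤ norm2 u + norm2 v := lpNorm_add_le hu (by norm_num)

theorem Gam_nonneg (w : Space d) (u : Space d → ℝ) : 0 ≤ Gam w u := lpNorm_nonneg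

theorem Gam_le_two_mul {u : Space d → ℝ} (hu : MemLp u 2 volume) (w : Space d) :
    Gam w u ≤ 2 * norm2 u := by
  have h : Gam w u ≤ norm2 (shift w u) + norm2 u :=
    lpNorm_sub_le (memLp_shift hu w) (by norm_num)
  rw [norm2_shift hu] at h
  linarith

theorem Gam_add_le {u : Space d → ℝ} (hu : MemLp u 2 volume) (w z : Space d) :
    Gam (w + z) u ≤ Gam w u + Gam z u := by
  have h1 : shift (w + z) u - u = shift w (shift z u - u) + (shift w u - u) := by
    ext x
    simp [shift, add_assoc]
  rw [Gam, h1]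
  have h2 := (memLp_shift hu z).sub hu
  refine (norm2_add_le (memLp_shift h2 w)).trans ?_
  rw [norm2_shift h2, add_comm]
  rfl

theorem Gam_zero (u : Space d → ℝ) : Gam 0 u = 0 := by
  have : shift 0 u - u = 0 := by ext; simp [shift]
  rw [Gam, this]
  exact lpNorm_zero _ _

theorem Gam_natCast_smul_le {u : Space d → ℝ} (hu : MemLp u 2 volume) (w : Space d) (n : ℕ) :
    Gam ((n : ℝ) • w) u ≤ n * Gam w u := by
  induction n with
  | zero => simp [Gam_zero]
  | succ k ih =>
    have := Gam_add_le hu ((k : ℝ) • w) w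
    push_cast
    rw [add_smul, one_smul, add_mul, one_mul]
    linarith

/-- A bound on small translations gives a bound on larger translations. -/
theorem Gam_le_of_norm_le_mul {u : Space d → ℝ} (hu : MemLp u 2 volume) {h S : ℝ} {R : ℕ}
    (hR : 0 < R) (hS : ∀ w : Space d, ‖w‖ ≤ h → Gam w u ≤ S) {w : Space d} (hw : ‖w‖ ≤ R * h) :
    Gam w u ≤ R * S := by
  have hR' : (0 : ℝ) < R := by exact_mod_cast hR
  have h1 : w = (R : ℝ) • ((R : ℝ)⁻¹ • w) := by rw [smul_smul, mul_inv_cancel₀ hR'.ne', one_smul]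
  rw [h1]
  refine (Gam_natCast_smul_le hu _ R).trans ?_
  refine mul_le_mul_of_nonneg_left (hS _ ?_) hR'.le
  rw [norm_smul, Real.norm_of_nonneg (by positivity), inv_mul_le_iff₀ hR']
  exact hw

end Shift

end HatFE

namespace HatFE

variable {d : ℕ}

/-! ### Averages over segments -/

section Line

/-- The law of `(x, x + σ w)`, where `x` is Lebesgue distributed and `σ` is uniform in `[0, 1]`. -/
noncomputable def lineMeasure (w : Space d) : Measure (Space d × Space d) :=
  ((volume.restrict (Set.Ioc (0 : ℝ) 1)).prod volume).map
    (fun q : ℝ × Space d => (q.2, q.2 + q.1 • w))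

instance isProbabilityMeasure_unitInterval :
    IsProbabilityMeasure (volume.restrict (Set.Ioc (0 : ℝ) 1)) := ⟨by simp⟩

theorem measurable_line (w : Space d) :
    Measurable (fun q : ℝ × Space d => (q.2, q.2 + q.1 • w)) := by fun_prop

theorem measurePreserving_line_skew (w : Space d) :
    MeasurePreserving (fun q : ℝ × Space d => (q.1, q.2 + q.1 • w))
      ((volume.restrict (Set.Ioc (0 : ℝ) 1)).prod volume)
      ((volume.restrict (Set.Ioc (0 : ℝ) 1)).prod volume) :=
  (MeasurePreserving.id _).skew_product (g := fun σ x => x + σ • w) (by fun_prop)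
    (ae_of_all _ fun σ => (measurePreserving_add_const (σ • w)).map_eq)

theorem isCoupling_lineMeasure (w : Space d) : IsCoupling (lineMeasure w) where
  fst := by
    refine ⟨measurable_fst, ?_⟩
    rw [lineMeasure, Measure.map_map measurable_fst (measurable_line w)]
    exact measurePreserving_snd.map_eq
  snd := by
    refine ⟨measurable_snd, ?_⟩
    rw [lineMeasure, Measure.map_map measurable_snd (measurable_line w)]
    exact (measurePreserving_snd.comp (measurePreserving_line_skew w)).map_eq

theorem integrable_line {f φ : Space d → ℝ} (hf : MemLp f 2 volume) (hφ : MemLp φ 2 volume)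
    (w : Space d) : Integrable (fun q : ℝ × Space d => f q.2 * φ (q.2 - q.1 • w))
      ((volume.restrict (Set.Ioc (0 : ℝ) 1)).prod volume) := by
  have hs := measurePreserving_line_skew (-w)
  refine integrable_mul_of_memLp_two (hf.comp_measurePreserving measurePreserving_snd) ?_
  have := hφ.comp_measurePreserving (measurePreserving_snd.comp hs)
  simpa [Function.comp_def, sub_eq_add_neg] using this

/-- The measure preserving shear `(σ, x) ↦ (σ, x + σ w)` moves the translation from `f` to `φ`,
which may be smooth and can then be integrated or differentiated along the segment. -/
theorem pairing_lineMeasure {f φ : Space d → ℝ} (hf : MemLp f 2 volume) (hφ : MemLp φ 2 volume)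
    (w : Space d) : ∫ p, f p.2 * φ p.1 ∂(lineMeasure w) =
      ∫ q, f q.2 * φ (q.2 - q.1 • w) ∂((volume.restrict (Set.Ioc (0 : ℝ) 1)).prod volume) := by
  have h1 := ((isCoupling_lineMeasure w).integrable_pairing hf hφ).1
  have h2 := (integrable_line hf hφ w).1
  have hs := measurePreserving_line_skew w
  rw [lineMeasure] at h1 ⊢
  rw [integral_map (measurable_line w).aemeasurable h1]
  nth_rewrite 2 [← hs.map_eq]
  rw [integral_map hs.measurable.aemeasurable (by rw [hs.map_eq]; exact h2)]
  simp

/-- The oscillation along segments is controlled by translations. -/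
theorem osc_lineMeasure_le {f : Space d → ℝ} (hf : MemLp f 2 volume) {w : Space d} {S : ℝ}
    (hS : ∀ σ : ℝ, 0 ≤ σ → σ ≤ 1 → Gam (σ • w) f ≤ S) : osc (lineMeasure w) f ≤ S := by
  have hS0 : 0 ≤ S := (Gam_nonneg _ _).trans (hS 0 le_rfl zero_le_one)
  have hΛ := isCoupling_lineMeasure w
  have hm := ((hΛ.memLp_snd hf).sub (hΛ.memLp_fst hf)).1
  refine lpNorm_two_le_of_lintegral_sq_le hm hS0 ?_
  have hm2 : AEMeasurable (fun p : Space d × Space d => ‖f p.2 - f p.1‖ₑ ^ 2) (lineMeasure w) :=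
    hm.enorm.pow_const 2
  change ∫⁻ p, ‖f p.2 - f p.1‖ₑ ^ 2 ∂lineMeasure w ≤ _
  rw [lineMeasure] at hm2 ⊢
  have hm3 := hm2.comp_measurable (measurable_line w)
  simp only [Function.comp_def] at hm3
  rw [lintegral_map' hm2 (measurable_line w).aemeasurable, lintegral_prod _ hm3]
  calc _ ≤ ∫⁻ _σ in Set.Ioc (0 : ℝ) 1, ENNReal.ofReal (S ^ 2) := by
        refine setLIntegral_mono measurable_const fun σ hσ => ?_
        exact lintegral_sq_le_of_lpNorm_two_le ((memLp_shift hf (σ • w)).sub hf)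
          (hS σ hσ.1.le hσ.2)
    _ = ENNReal.ofReal (S ^ 2) := by simp

end Line

/-! ### Difference quotients and weak derivatives -/

section FinDiff

theorem contDiff_partial {φ : Space d → ℝ} (hφ : ContDiff ℝ ∞ φ) (v : Space d) :
    ContDiff ℝ ∞ (fun x => fderiv ℝ φ x v) :=
  (hφ.fderiv_right (m := ∞) (by simp)).clm_apply contDiff_const

theorem memLp_partial {φ : Space d → ℝ} (hφ : ContDiff ℝ ∞ φ) (hc : HasCompactSupport φ)
    (v : Space d) : MemLp (fun x => fderiv ℝ φ x v) 2 volume :=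
  memLp_of_test (contDiff_partial hφ v) (hc.fderiv_apply ℝ v)

theorem memLp_finDiff {u : Space d → ℝ} (hu : MemLp u 2 volume) (t : Fin d → ℝ) (i : Fin d) :
    MemLp (finDiff t u i) 2 volume :=
  ((memLp_shift hu (EuclideanSpace.single i (t i))).sub hu).const_mul _

theorem integral_partial_along_line {φ : Space d → ℝ} (hφ : ContDiff ℝ ∞ φ) (i : Fin d) {t : ℝ}
    (ht : t ≠ 0) (x : Space d) :
    ∫ σ in Set.Ioc (0 : ℝ) 1, fderiv ℝ φ (x - σ • EuclideanSpace.single i t)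
        (EuclideanSpace.single i 1) = t⁻¹ * (φ x - φ (x - EuclideanSpace.single i t)) := by
  have hs : (EuclideanSpace.single i t : Space d) = t • EuclideanSpace.single i 1 := by
    ext j; simp
  have hder : ∀ σ : ℝ, HasDerivAt (fun σ : ℝ => -t⁻¹ * φ (x - σ • EuclideanSpace.single i t))
      (fderiv ℝ φ (x - σ • EuclideanSpace.single i t) (EuclideanSpace.single i 1)) σ := by
    intro σ
    have h1 : HasDerivAt (fun σ : ℝ => x - σ • (EuclideanSpace.single i t : Space d))
        (-((1 : ℝ) • EuclideanSpace.single i t)) σ :=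
      ((hasDerivAt_id σ).smul_const _).const_sub x
    have h2 := ((hφ.differentiable (by simp)).differentiableAt.hasFDerivAt
      (x := x - σ • EuclideanSpace.single i t)).comp_hasDerivAt σ h1
    refine (h2.const_mul (-t⁻¹)).congr_deriv ?_
    nth_rewrite 2 [hs]
    rw [one_smul, map_neg, map_smul, smul_eq_mul]
    field_simp
  rw [← intervalIntegral.integral_of_le zero_le_one,
    intervalIntegral.integral_eq_sub_of_hasDerivAt (fun σ _ => hder σ)]
  · simp only [one_smul, zero_smul, sub_zero]; ring
  · refine Continuous.intervalIntegrable ?_ _ _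
    have := (contDiff_partial hφ (EuclideanSpace.single i 1)).continuous
    fun_prop

theorem integral_mul_sub_const (f φ : Space d → ℝ) (w : Space d) :
    ∫ x, f x * φ (x - w) = ip (shift w f) φ := by
  rw [← integral_add_right_eq_self _ w]
  simp [ip, shift]

/-- Summation by parts: difference quotients against smooth averages of partial derivatives. -/
theorem ip_finDiff_eq_neg_pairing {f φ : Space d → ℝ} (hf : MemLp f 2 volume)
    (hφ : ContDiff ℝ ∞ φ) (hc : HasCompactSupport φ) (t : Fin d → ℝ) (i : Fin d) (ht : t i ≠ 0) :
    ip (finDiff t f i) φ = -∫ p, f p.2 * fderiv ℝ φ p.1 (EuclideanSpace.single i 1)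
      ∂(lineMeasure (EuclideanSpace.single i (t i))) := by
  have hd := memLp_partial hφ hc (EuclideanSpace.single i 1)
  have hφ2 := memLp_of_test hφ hc
  rw [pairing_lineMeasure hf hd, integral_prod_symm _ (integrable_line hf hd _)]
  simp only [integral_const_mul, integral_partial_along_line hφ i ht]
  have h1 : ∀ x, f x * ((t i)⁻¹ * (φ x - φ (x - EuclideanSpace.single i (t i)))) =
      (t i)⁻¹ * (f x * φ x - f x * φ (x - EuclideanSpace.single i (t i))) := fun x => by ring
  have h2 : MemLp (fun x => φ (x - EuclideanSpace.single i (t i))) 2 volume := by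
    simpa [shift, ← sub_eq_add_neg] using! memLp_shift hφ2 (-EuclideanSpace.single i (t i))
  simp only [h1]
  rw [integral_const_mul, integral_sub (integrable_mul_of_memLp_two hf hφ2)
    (integrable_mul_of_memLp_two hf h2), integral_mul_sub_const]
  simp only [ip, finDiff, mul_assoc]
  rw [integral_const_mul]
  simp only [sub_mul]
  have h3 := integral_sub
    (integrable_mul_of_memLp_two (memLp_shift hf (EuclideanSpace.single i (t i))) hφ2)
    (integrable_mul_of_memLp_two hf hφ2)
  simp only [shift] at h3 ⊢
  rw [h3]
  ring

/-- The difference quotient is the average of the weak partial derivative over a segment. -/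
theorem represents_finDiff {u g : Space d → ℝ} {i : Fin d} (hu : MemLp u 2 volume)
    (hg : MemLp g 2 volume) (hug : HasWeakPartial i u g) (t : Fin d → ℝ) (ht : t i ≠ 0) :
    Represents (lineMeasure (EuclideanSpace.single i (t i))) g (finDiff t u i) := by
  refine (isCoupling_lineMeasure _).represents_of_test hg
    ((memLp_finDiff hu t i).locallyIntegrable (by norm_num)) fun φ hφ hc => ?_
  have hd := memLp_partial hφ hc (EuclideanSpace.single i 1)
  have hφ2 := memLp_of_test hφ hc
  rw [ip_finDiff_eq_neg_pairing hu hφ hc t i ht, pairing_lineMeasure hu hd,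
    pairing_lineMeasure hg hφ2, integral_prod _ (integrable_line hu hd _),
    integral_prod _ (integrable_line hg hφ2 _), ← integral_neg]
  congr 1
  ext σ
  -- For fixed `σ` the translate of `φ` is again a test function, so the weak derivative can be
  -- moved inside the average.
  have h := hug (fun x => φ (x - σ • EuclideanSpace.single i (t i)))
    (hφ.comp (contDiff_id.sub contDiff_const))
    (hc.comp_homeomorph (Homeomorph.subRight (σ • EuclideanSpace.single i (t i))))
  simp only [fderiv_comp_sub] at h
  simp only [h, neg_neg]

theorem hasWeakPartial_shift_sub {u g : Space d → ℝ} {i : Fin d} (hu : MemLp u 2 volume)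
    (hg : MemLp g 2 volume) (hug : HasWeakPartial i u g) (w : Space d) :
    HasWeakPartial i (shift w u - u) (shift w g - g) := by
  intro φ hφ hc
  have hd := memLp_partial hφ hc (EuclideanSpace.single i 1)
  have hφ2 := memLp_of_test hφ hc
  have h := hug (fun x => φ (x - w)) (hφ.comp (contDiff_id.sub contDiff_const))
    (hc.comp_homeomorph (Homeomorph.subRight w))
  have h0 := hug φ hφ hc
  simp only [fderiv_comp_sub] at h
  rw [integral_mul_sub_const u (fun x => fderiv ℝ φ x (EuclideanSpace.single i 1)),
    integral_mul_sub_const g φ] at h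
  simp only [Pi.sub_apply, sub_mul]
  rw [integral_sub (integrable_mul_of_memLp_two (memLp_shift hu _) hd)
    (integrable_mul_of_memLp_two hu hd), integral_sub
    (integrable_mul_of_memLp_two (memLp_shift hg _) hφ2) (integrable_mul_of_memLp_two hg hφ2), h0]
  simp only [ip] at h
  rw [h]
  ring

theorem norm2_finDiff_le {u g : Space d → ℝ} {i : Fin d} (hu : MemLp u 2 volume)
    (hg : MemLp g 2 volume) (hug : HasWeakPartial i u g) (t : Fin d → ℝ) (ht : t i ≠ 0) :
    norm2 (finDiff t u i) ≤ norm2 g :=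
  (isCoupling_lineMeasure _).norm2_le_of_represents hg (represents_finDiff hu hg hug t ht)

/-- Difference quotients commute with translations, so the contraction bound applies to the
translation difference of `u`, whose weak derivative is that of `g`. -/
theorem Gam_finDiff_le {u g : Space d → ℝ} {i : Fin d} (hu : MemLp u 2 volume)
    (hg : MemLp g 2 volume) (hug : HasWeakPartial i u g) (t : Fin d → ℝ) (ht : t i ≠ 0)
    (w : Space d) : Gam w (finDiff t u i) ≤ Gam w g := by
  have h : shift w (finDiff t u i) - finDiff t u i = finDiff t (shift w u - u) i := by
    ext x
    simp only [Pi.sub_apply, shift, finDiff, add_right_comm x _ w]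
    ring
  rw [Gam, h]
  exact norm2_finDiff_le ((memLp_shift hu w).sub hu) ((memLp_shift hg w).sub hg)
    (hasWeakPartial_shift_sub hu hg hug w) t ht

/-- A difference quotient moves slowly in the direction in which the difference is taken. -/
theorem Gam_single_finDiff_le {u g : Space d → ℝ} {i : Fin d} (hu : MemLp u 2 volume)
    (hg : MemLp g 2 volume) (hug : HasWeakPartial i u g) (t : Fin d → ℝ) (σ : ℝ) :
    Gam (EuclideanSpace.single i σ) (finDiff t u i) ≤
      |(t i)⁻¹| * |σ| * Gam (EuclideanSpace.single i (t i)) g := by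
  rcases eq_or_ne σ 0 with rfl | hσ
  · have : (EuclideanSpace.single i 0 : Space d) = 0 := by ext j; simp
    rw [this, Gam_zero]
    simp
  set w : Space d := EuclideanSpace.single i (t i)
  -- The two differences, with steps `t i` and `σ`, commute; dividing by `σ` instead of `t i` leaves
  -- the factor `σ / t i`.
  have h : shift (EuclideanSpace.single i σ) (finDiff t u i) - finDiff t u i =
      ((t i)⁻¹ * σ) • finDiff (fun _ => σ) (shift w u - u) i := by
    ext x
    simp only [Pi.sub_apply, shift, finDiff, Pi.smul_apply, smul_eq_mul]
    field_simp
    ring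
  have h2 := norm2_finDiff_le ((memLp_shift hu w).sub hu) ((memLp_shift hg w).sub hg)
    (hasWeakPartial_shift_sub hu hg hug w) (fun _ => σ) hσ
  rw [Gam, h, norm2, lpNorm_const_smul, ← abs_mul]
  exact mul_le_mul_of_nonneg_left h2 (abs_nonneg _)

/-- Intermediate translations in the direction of the difference quotient are controlled by the
error of the difference quotient and a single translation. -/
theorem Gam_single_le {u g : Space d → ℝ} {i : Fin d} (hu : MemLp u 2 volume)
    (hg : MemLp g 2 volume) (hug : HasWeakPartial i u g) (t : Fin d → ℝ) {h : ℝ} (hh : 0 < h)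
    {k : ℕ} (hk : 0 < k) (ht : t i = h * k) {σ : ℝ} (hσ : |σ| ≤ h) :
    Gam (EuclideanSpace.single i σ) g ≤
      2 * norm2 (g - finDiff t u i) + Gam (EuclideanSpace.single i h) g := by
  have hD := memLp_finDiff hu t i
  have h1 : shift (EuclideanSpace.single i σ) g - g =
      (shift (EuclideanSpace.single i σ) (g - finDiff t u i) - (g - finDiff t u i)) +
      (shift (EuclideanSpace.single i σ) (finDiff t u i) - finDiff t u i) := by
    ext x
    simp only [Pi.sub_apply, Pi.add_apply, shift]
    ring
  have h2 := norm2_add_le (v := shift (EuclideanSpace.single i σ) (finDiff t u i) - finDiff t u i)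
    ((memLp_shift (hg.sub hD) (EuclideanSpace.single i σ)).sub (hg.sub hD))
  have h3 := Gam_le_two_mul (hg.sub hD) (EuclideanSpace.single i σ)
  have h4 := Gam_single_finDiff_le hu hg hug t σ
  have hk' : (0 : ℝ) < k := by exact_mod_cast hk
  have h5 : Gam (EuclideanSpace.single i (t i)) g ≤ k * Gam (EuclideanSpace.single i h) g := by
    have : (EuclideanSpace.single i (t i) : Space d) = (k : ℝ) • EuclideanSpace.single i h := by
      ext j; simp [ht, mul_comm]
    rw [this]
    exact Gam_natCast_smul_le hg _ _
  -- The factor `k` from splitting the step `t i` into `k` steps `h` is regained from `|σ| / t i ≤ 1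
  -- / k`.
  have h6 : |(t i)⁻¹| * |σ| * Gam (EuclideanSpace.single i (t i)) g ≤
      Gam (EuclideanSpace.single i h) g := by
    have h7 : |(t i)⁻¹| * |σ| ≤ (k : ℝ)⁻¹ := by
      rw [ht, abs_of_pos (by positivity), mul_inv, mul_right_comm]
      refine mul_le_of_le_one_left (by positivity) ?_
      rwa [inv_mul_le_iff₀ hh, mul_one]
    calc _ ≤ (k : ℝ)⁻¹ * (k * Gam (EuclideanSpace.single i h) g) :=
          mul_le_mul h7 h5 (Gam_nonneg _ _) (by positivity)
      _ = _ := by field_simp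
  rw [Gam, h1]
  simp only [Gam] at h3 h4 h6 ⊢
  linarith

end FinDiff

end HatFE

namespace HatFE

/-! ### Partitions of unity and grid couplings -/

variable {d : ℕ} {ι : Type*}

/-- A partition of unity by nonnegative functions, all of integral `N`. -/
structure IsPartition (θ : ι → Space d → ℝ) (N : ℝ) : Prop where
  measurable : ∀ l, Measurable (θ l)
  nonneg : ∀ l x, 0 ≤ θ l x
  integrable : ∀ l, Integrable (θ l) volume
  integral_eq : ∀ l, ∫ x, θ l x = N
  hasSum_one : ∀ x, HasSum (fun l => θ l x) 1

namespace IsPartition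

variable {θ : ι → Space d → ℝ} {N : ℝ}

theorem le_one (h : IsPartition θ N) (l : ι) (x : Space d) : θ l x ≤ 1 :=
  le_hasSum (h.hasSum_one x) l fun j _ => h.nonneg j x

theorem memLp_two (h : IsPartition θ N) (l : ι) : MemLp (θ l) 2 volume := by
  refine (memLp_two_iff_integrable_sq (h.measurable l).aestronglyMeasurable).2 ?_
  refine (h.integrable l).mono' ((h.measurable l).pow_const 2).aestronglyMeasurable
    (ae_of_all _ fun x => ?_)
  have h0 := h.nonneg l x
  have h1 := h.le_one l x
  rw [Real.norm_of_nonneg (by positivity)]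
  nlinarith

theorem norm2_sq_le (h : IsPartition θ N) (l : ι) : norm2 (θ l) ^ 2 ≤ N := by
  rw [norm2, ← integral_mul_self_eq_lpNorm_sq (h.memLp_two l), ← h.integral_eq l]
  refine integral_mono (integrable_mul_of_memLp_two (h.memLp_two l) (h.memLp_two l))
    (h.integrable l) fun x => ?_
  exact mul_le_of_le_one_left (h.nonneg l x) (h.le_one l x)

theorem lintegral_ofReal (h : IsPartition θ N) (l : ι) :
    ∫⁻ x, ENNReal.ofReal (θ l x) = ENNReal.ofReal N := by
  rw [← h.integral_eq l, ofReal_integral_eq_lintegral_ofReal (h.integrable l)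
    (ae_of_all _ (h.nonneg l))]

theorem tsum_ofReal (h : IsPartition θ N) (x : Space d) : ∑' l, ENNReal.ofReal (θ l x) = 1 := by
  rw [← ENNReal.ofReal_tsum_of_nonneg (fun l => h.nonneg l x) (h.hasSum_one x).summable,
    (h.hasSum_one x).tsum_eq, ENNReal.ofReal_one]

end IsPartition

/-- The density of the coupling defined by two partitions of unity. -/
noncomputable def gridDensity (θ ψ : ι → Space d → ℝ) (N : ℝ) (l : ι) :
    Space d × Space d → ENNReal :=
  fun p => ENNReal.ofReal N⁻¹ * (ENNReal.ofReal (θ l p.1) * ENNReal.ofReal (ψ l p.2))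

/-- The coupling `∑_l N⁻¹ θ_l(x) ψ_l(y) dx dy`. -/
noncomputable def gridMeasure (θ ψ : ι → Space d → ℝ) (N : ℝ) : Measure (Space d × Space d) :=
  Measure.sum fun l => (volume.prod volume).withDensity (gridDensity θ ψ N l)

/-- The averaging operator `f ↦ ∑_l N⁻¹ (ψ_l | f) θ_l`. -/
noncomputable def gridOp (θ ψ : ι → Space d → ℝ) (N : ℝ) (f : Space d → ℝ) : Space d → ℝ :=
  fun x => ∑' l, N⁻¹ * ip (ψ l) f * θ l x

section Grid

variable {θ ψ : ι → Space d → ℝ} {N : ℝ}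

theorem measurable_gridDensity (hθ : IsPartition θ N) (hψ : IsPartition ψ N) (l : ι) :
    Measurable (gridDensity θ ψ N l) := by
  have h1 := hθ.measurable l
  have h2 := hψ.measurable l
  unfold gridDensity
  fun_prop

theorem lintegral_gridMeasure (hθ : IsPartition θ N) (hψ : IsPartition ψ N)
    {G : Space d × Space d → ENNReal} (hG : Measurable G) :
    ∫⁻ p, G p ∂(gridMeasure θ ψ N) =
      ∑' l, ∫⁻ p, gridDensity θ ψ N l p * G p ∂(volume.prod volume) := by
  rw [gridMeasure, lintegral_sum_measure]
  congr 1
  ext l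
  exact lintegral_withDensity_eq_lintegral_mul _ (measurable_gridDensity hθ hψ l) hG

theorem inv_mul_lintegral_ofReal (hN : 0 < N) (hθ : IsPartition θ N) (l : ι) :
    ∫⁻ x, ENNReal.ofReal N⁻¹ * ENNReal.ofReal (θ l x) = 1 := by
  rw [lintegral_const_mul _ (hθ.measurable l).ennreal_ofReal, hθ.lintegral_ofReal,
    ← ENNReal.ofReal_mul (inv_pos.2 hN).le, inv_mul_cancel₀ hN.ne', ENNReal.ofReal_one]

/-- Since `0 ≤ ψ_l ≤ 1`, the squared norm of `ψ_l` is at most its integral `N`. The bound is uniform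
in `l`, so `∑ θ_l = 1` makes the series converge absolutely at every point. -/
theorem abs_coeff_le (hN : 0 < N) (hψ : IsPartition ψ N) {f : Space d → ℝ}
    (hf : MemLp f 2 volume) (l : ι) : |N⁻¹ * ip (ψ l) f| ≤ N⁻¹ * (Real.sqrt N * norm2 f) := by
  rw [abs_mul, abs_of_pos (inv_pos.2 hN)]
  refine mul_le_mul_of_nonneg_left ?_ (inv_pos.2 hN).le
  refine (abs_integral_mul_le_lpNorm (hψ.memLp_two l) hf).trans ?_
  exact mul_le_mul_of_nonneg_right (Real.le_sqrt_of_sq_le (hψ.norm2_sq_le l)) (norm2_nonneg f)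

theorem summable_gridOp (hN : 0 < N) (hθ : IsPartition θ N) (hψ : IsPartition ψ N)
    {f : Space d → ℝ} (hf : MemLp f 2 volume) (x : Space d) :
    Summable fun l => N⁻¹ * ip (ψ l) f * θ l x := by
  refine Summable.of_norm_bounded
    ((hθ.hasSum_one x).summable.mul_left (N⁻¹ * (Real.sqrt N * norm2 f))) fun l => ?_
  rw [norm_mul, Real.norm_of_nonneg (hθ.nonneg l x)]
  exact mul_le_mul_of_nonneg_right (abs_coeff_le hN hψ hf l) (hθ.nonneg l x)

variable [Countable ι]

/-- Integrating out one variable cancels `N⁻¹` against the integral of its factor; the other factors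
sum to one. -/
theorem isCoupling_gridMeasure (hN : 0 < N) (hθ : IsPartition θ N) (hψ : IsPartition ψ N) :
    IsCoupling (gridMeasure θ ψ N) where
  fst := by
    refine ⟨measurable_fst, Measure.ext_of_lintegral _ fun F hF => ?_⟩
    rw [lintegral_map hF measurable_fst,
      lintegral_gridMeasure hθ hψ (G := fun p => F p.1) (hF.comp measurable_fst)]
    calc _ = ∑' l, ∫⁻ x, ENNReal.ofReal (θ l x) * F x := by
          congr 1
          ext l
          rw [← one_mul (∫⁻ x, _), ← inv_mul_lintegral_ofReal hN hψ l, mul_comm]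
          refine Eq.trans (lintegral_congr fun p => ?_)
            (lintegral_prod_mul (((hθ.measurable l).ennreal_ofReal.mul hF).aemeasurable)
              (((hψ.measurable l).ennreal_ofReal.const_mul _).aemeasurable))
          simp only [gridDensity]
          ring
      _ = ∫⁻ x, F x := by
          refine (lintegral_tsum fun l =>
            ((hθ.measurable l).ennreal_ofReal.mul hF).aemeasurable).symm.trans ?_
          refine lintegral_congr fun x => ?_
          simp [ENNReal.tsum_mul_right, hθ.tsum_ofReal]
  snd := by
    refine ⟨measurable_snd, Measure.ext_of_lintegral _ fun F hF => ?_⟩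
    rw [lintegral_map hF measurable_snd,
      lintegral_gridMeasure hθ hψ (G := fun p => F p.2) (hF.comp measurable_snd)]
    calc _ = ∑' l, ∫⁻ x, ENNReal.ofReal (ψ l x) * F x := by
          congr 1
          ext l
          rw [← one_mul (∫⁻ x, _), ← inv_mul_lintegral_ofReal hN hθ l]
          refine Eq.trans (lintegral_congr fun p => ?_)
            (lintegral_prod_mul (((hθ.measurable l).ennreal_ofReal.const_mul _).aemeasurable)
              (((hψ.measurable l).ennreal_ofReal.mul hF).aemeasurable))
          simp only [gridDensity]
          ring
      _ = ∫⁻ x, F x := by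
          refine (lintegral_tsum fun l =>
            ((hψ.measurable l).ennreal_ofReal.mul hF).aemeasurable).symm.trans ?_
          refine lintegral_congr fun x => ?_
          simp [ENNReal.tsum_mul_right, hψ.tsum_ofReal]

theorem hasSum_pairing_gridMeasure (hN : 0 < N) (hθ : IsPartition θ N) (hψ : IsPartition ψ N)
    {f φ : Space d → ℝ} (hf : MemLp f 2 volume) (hφ : MemLp φ 2 volume) :
    HasSum (fun l => N⁻¹ * ip (ψ l) f * ip (θ l) φ)
      (∫ p, f p.2 * φ p.1 ∂(gridMeasure θ ψ N)) := by
  have h := (isCoupling_gridMeasure hN hθ hψ).integrable_pairing hf hφ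
  unfold gridMeasure at h ⊢
  have hs := hasSum_integral_measure h
  refine (congrArg (fun F => HasSum F _) (funext fun l => ?_)).mpr hs
  rw [integral_withDensity_eq_integral_toReal_smul (measurable_gridDensity hθ hψ l)
    (ae_of_all _ fun p => by simp [gridDensity, ENNReal.mul_lt_top])]
  have h1 : ∀ p : Space d × Space d, (gridDensity θ ψ N l p).toReal • (f p.2 * φ p.1) =
      (θ l p.1 * φ p.1) * (N⁻¹ * (ψ l p.2 * f p.2)) := by
    intro p
    simp only [gridDensity, ENNReal.toReal_mul, smul_eq_mul,
      ENNReal.toReal_ofReal (hθ.nonneg l p.1), ENNReal.toReal_ofReal (hψ.nonneg l p.2),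
      ENNReal.toReal_ofReal (inv_nonneg.2 hN.le)]
    ring
  simp only [h1]
  rw [integral_prod_mul (fun x => θ l x * φ x) (fun y => N⁻¹ * (ψ l y * f y)),
    integral_const_mul]
  simp only [ip]
  ring

theorem locallyIntegrable_gridOp (hN : 0 < N) (hθ : IsPartition θ N) (hψ : IsPartition ψ N)
    {f : Space d → ℝ} (hf : MemLp f 2 volume) : LocallyIntegrable (gridOp θ ψ N f) := by
  refine (locallyIntegrable_const (N⁻¹ * (Real.sqrt N * norm2 f))).mono ?_
    (ae_of_all _ fun x => ?_)
  · refine Measurable.aestronglyMeasurable ?_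
    refine measurable_of_tendsto_metrizable' Filter.atTop (f := fun (s : Finset ι) x =>
      ∑ l ∈ s, N⁻¹ * ip (ψ l) f * θ l x) (fun s => ?_) ?_
    · exact Finset.measurable_sum _ fun l _ => (hθ.measurable l).const_mul _
    · exact tendsto_pi_nhds.2 fun x => (summable_gridOp hN hθ hψ hf x).hasSum
  · refine (tsum_of_norm_bounded ((hθ.hasSum_one x).mul_left
      (N⁻¹ * (Real.sqrt N * norm2 f))) fun l => ?_).trans ?_
    · rw [norm_mul, Real.norm_of_nonneg (hθ.nonneg l x)]
      exact mul_le_mul_of_nonneg_right (abs_coeff_le hN hψ hf l) (hθ.nonneg l x)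
    · rw [mul_one]; exact le_abs_self _

/-- Both sides equal `∑_l N⁻¹ (ψ_l | f) (θ_l | φ)`: the right side by splitting `Λ` into its
summands, the left by termwise integration. -/
theorem represents_gridOp (hN : 0 < N) (hθ : IsPartition θ N) (hψ : IsPartition ψ N)
    {f : Space d → ℝ} (hf : MemLp f 2 volume) :
    Represents (gridMeasure θ ψ N) f (gridOp θ ψ N f) := by
  refine (isCoupling_gridMeasure hN hθ hψ).represents_of_test hf
    (locallyIntegrable_gridOp hN hθ hψ hf) fun φ h1 h2 => ?_
  have hφ := memLp_of_test h1 h2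
  -- The same series for `|f|` and `|φ|` is the summable majorant that justifies termwise
  -- integration.
  have hs := (hasSum_pairing_gridMeasure hN hθ hψ hf.abs hφ.abs).summable
  have h3 := hasSum_integral_of_summable_integral_norm (μ := volume)
    (F := fun l x => N⁻¹ * ip (ψ l) f * (θ l x * φ x))
    (fun l => (integrable_mul_of_memLp_two (hθ.memLp_two l) hφ).const_mul _) ?_
  · have h4 : HasSum (fun l => N⁻¹ * ip (ψ l) f * ip (θ l) φ) (ip (gridOp θ ψ N f) φ) := by
      simp only [integral_const_mul] at h3
      have h5 : ip (gridOp θ ψ N f) φ = ∫ x, ∑' l, N⁻¹ * ip (ψ l) f * (θ l x * φ x) := by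
        refine integral_congr_ae (ae_of_all _ fun x => ?_)
        simp only [gridOp, ← mul_assoc]
        rw [tsum_mul_right]
      rw [h5]
      exact h3
    exact h4.unique (hasSum_pairing_gridMeasure hN hθ hψ hf hφ)
  · refine Summable.of_nonneg_of_le (fun l => integral_nonneg fun x => norm_nonneg _)
      (fun l => ?_) hs
    have h5 : |ip (ψ l) f| ≤ ip (ψ l) |f| := by
      refine (abs_integral_le_integral_abs (f := fun y => ψ l y * f y)).trans_eq
        (integral_congr_ae (ae_of_all _ fun y => ?_))
      simp [abs_mul, abs_of_nonneg (hψ.nonneg l y)]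
    have h6 : ∫ x, ‖N⁻¹ * ip (ψ l) f * (θ l x * φ x)‖ = N⁻¹ * |ip (ψ l) f| * ip (θ l) |φ| := by
      simp only [norm_mul, Real.norm_eq_abs, abs_inv, abs_of_pos hN, integral_const_mul,
        abs_of_nonneg (hθ.nonneg l _)]
      rfl
    rw [h6]
    have h7 : 0 ≤ ip (θ l) |φ| :=
      integral_nonneg fun x => mul_nonneg (hθ.nonneg l x) (abs_nonneg _)
    gcongr

theorem hasSum_ip_gridOp (hN : 0 < N) (hθ : IsPartition θ N) (hψ : IsPartition ψ N)
    {f φ : Space d → ℝ} (hf : MemLp f 2 volume) (hφ : MemLp φ 2 volume) :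
    HasSum (fun l => N⁻¹ * ip (ψ l) f * ip (θ l) φ) (ip (gridOp θ ψ N f) φ) := by
  rw [(represents_gridOp hN hθ hψ hf).2 φ hφ]
  exact hasSum_pairing_gridMeasure hN hθ hψ hf hφ

end Grid

/-! ### Oscillation at the grid scale -/

section Oscillation

variable [Countable ι] {θ ψ : ι → Space d → ℝ} {N ρ : ℝ}

/-- By `ψ_l ≤ 1` and `∑ θ_l = 1` the density is at most `N⁻¹`; at distance beyond `ρ` every summand
vanishes. -/
theorem gridMeasure_le_withDensity (hθ : IsPartition θ N) (hψ : IsPartition ψ N)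
    (hρ : ∀ l x y, θ l x ≠ 0 → ψ l y ≠ 0 → ‖y - x‖ ≤ ρ) :
    gridMeasure θ ψ N ≤ (volume.prod volume).withDensity (fun p => ENNReal.ofReal N⁻¹ *
      (Metric.closedBall (0 : Space d) ρ).indicator 1 (p.2 - p.1)) := by
  rw [gridMeasure, ← withDensity_tsum (measurable_gridDensity hθ hψ)]
  refine withDensity_mono (ae_of_all _ fun p => ?_)
  rw [tsum_apply (Pi.summable.2 fun _ => ENNReal.summable)]
  simp only [gridDensity]
  rw [ENNReal.tsum_mul_left]
  refine mul_le_mul_right ?_ _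
  by_cases hp : ‖p.2 - p.1‖ ≤ ρ
  · rw [Set.indicator_of_mem (by simpa using hp), Pi.one_apply, ← hθ.tsum_ofReal p.1]
    refine ENNReal.tsum_le_tsum fun l => mul_le_of_le_one_right' ?_
    rw [← ENNReal.ofReal_one]
    exact ENNReal.ofReal_le_ofReal (hψ.le_one l p.2)
  · refine le_of_eq_of_le (ENNReal.tsum_eq_zero.2 fun l => ?_) zero_le
    by_contra h
    rw [mul_eq_zero, not_or] at h
    exact hp (hρ l p.1 p.2 (fun h0 => h.1 (by simp [h0])) fun h0 => h.2 (by simp [h0]))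

theorem aemeasurable_sq_sub {f : Space d → ℝ} (hf : MemLp f 2 volume) :
    AEMeasurable (fun p : Space d × Space d => ‖f p.2 - f p.1‖ₑ ^ 2) (volume.prod volume) := by
  have h1 : AEStronglyMeasurable (fun p : Space d × Space d => f p.2 - f p.1)
    (volume.prod volume) := hf.1.comp_snd.sub hf.1.comp_fst
  exact h1.enorm.pow_const 2

theorem aemeasurable_sq_translate_sub {f : Space d → ℝ} (hf : MemLp f 2 volume)
    (B : Set (Space d)) :
    AEMeasurable (fun p : Space d × Space d => ‖f (p.1 + p.2) - f p.1‖ₑ ^ 2)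
      (volume.prod (volume.restrict B)) := by
  have hq : MeasurePreserving (fun p : Space d × Space d => (p.1, p.2 + p.1))
      ((volume.restrict B).prod volume) ((volume.restrict B).prod volume) :=
    (MeasurePreserving.id _).skew_product (g := fun w x => x + w) (by fun_prop)
      (ae_of_all _ fun w => (measurePreserving_add_const w).map_eq)
  have h1 : AEStronglyMeasurable (fun p : Space d × Space d => f (p.1 + p.2))
      (volume.prod (volume.restrict B)) :=
    ((hf.1.comp_snd (μ := volume.restrict B)).comp_measurePreserving hq).prod_swap
  have h2 : AEStronglyMeasurable (fun p : Space d × Space d => f (p.1 + p.2) - f p.1)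
      (volume.prod (volume.restrict B)) := h1.sub hf.1.comp_fst
  exact h2.enorm.pow_const 2

/-- The oscillation at the scale of the grid is controlled by translations. -/
theorem osc_gridMeasure_le (hN : 0 < N) (hθ : IsPartition θ N) (hψ : IsPartition ψ N)
    (hρ : ∀ l x y, θ l x ≠ 0 → ψ l y ≠ 0 → ‖y - x‖ ≤ ρ) {K : ℝ} (hK : 0 ≤ K)
    (hvol : volume (Metric.closedBall (0 : Space d) ρ) ≤ ENNReal.ofReal (N * K ^ 2))
    {f : Space d → ℝ} (hf : MemLp f 2 volume) {S : ℝ} (hS0 : 0 ≤ S)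
    (hS : ∀ w : Space d, ‖w‖ ≤ ρ → Gam w f ≤ S) : osc (gridMeasure θ ψ N) f ≤ K * S := by
  have hΛ := isCoupling_gridMeasure hN hθ hψ
  have hB : MeasurableSet (Metric.closedBall (0 : Space d) ρ) := measurableSet_closedBall
  have hk : Measurable (fun p : Space d × Space d => ENNReal.ofReal N⁻¹ *
      (Metric.closedBall (0 : Space d) ρ).indicator (1 : Space d → ENNReal) (p.2 - p.1)) :=
    ((measurable_one.indicator hB).comp (measurable_snd.sub measurable_fst)).const_mul _
  refine lpNorm_two_le_of_lintegral_sq_le ((hΛ.memLp_snd hf).sub (hΛ.memLp_fst hf)).1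
    (mul_nonneg hK hS0) ?_
  have hG := aemeasurable_sq_sub hf
  calc _ = ∫⁻ p, ‖f p.2 - f p.1‖ₑ ^ 2 ∂(gridMeasure θ ψ N) := rfl
    _ ≤ ∫⁻ p, ‖f p.2 - f p.1‖ₑ ^ 2 ∂((volume.prod volume).withDensity _) :=
      lintegral_mono' (gridMeasure_le_withDensity hθ hψ hρ) le_rfl
    _ = ∫⁻ p : Space d × Space d, (ENNReal.ofReal N⁻¹ *
          (Metric.closedBall (0 : Space d) ρ).indicator 1 (p.2 - p.1)) *
          ‖f p.2 - f p.1‖ₑ ^ 2 ∂(volume.prod volume) :=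
      lintegral_withDensity_eq_lintegral_mul₀ hk.aemeasurable hG
    _ = ∫⁻ x, ∫⁻ y, (ENNReal.ofReal N⁻¹ *
          (Metric.closedBall (0 : Space d) ρ).indicator 1 (y - x)) * ‖f y - f x‖ₑ ^ 2 :=
      lintegral_prod _ (hk.aemeasurable.mul hG)
    _ = ∫⁻ x, ∫⁻ w in Metric.closedBall 0 ρ,
          ENNReal.ofReal N⁻¹ * ‖f (x + w) - f x‖ₑ ^ 2 := by
      refine lintegral_congr fun x => ?_
      -- The substitution `y = x + w` makes the kernel depend on `w` alone, so exchanging the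
      -- integrals leaves translation norms averaged over a ball.
      rw [← lintegral_add_left_eq_self _ x, ← lintegral_indicator hB]
      refine lintegral_congr fun w => ?_
      by_cases hw : w ∈ Metric.closedBall (0 : Space d) ρ
      · simp only [add_sub_cancel_left, Set.indicator_of_mem hw, Pi.one_apply, mul_one]
      · simp only [add_sub_cancel_left, Set.indicator_of_notMem hw, mul_zero, zero_mul]
    _ = ∫⁻ w in Metric.closedBall 0 ρ, ∫⁻ x,
          ENNReal.ofReal N⁻¹ * ‖f (x + w) - f x‖ₑ ^ 2 :=
      lintegral_lintegral_swap ((aemeasurable_sq_translate_sub hf _).const_mul _)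
    _ ≤ ∫⁻ _w in Metric.closedBall (0 : Space d) ρ,
          ENNReal.ofReal N⁻¹ * ENNReal.ofReal (S ^ 2) := by
      refine setLIntegral_mono measurable_const fun w hw => ?_
      rw [lintegral_const_mul' _ _ ENNReal.ofReal_ne_top]
      refine mul_le_mul_right ?_ _
      exact lintegral_sq_le_of_lpNorm_two_le ((memLp_shift hf w).sub hf)
        (hS w (by simpa using hw))
    _ = ENNReal.ofReal N⁻¹ * ENNReal.ofReal (S ^ 2) * volume (Metric.closedBall (0 : Space d) ρ) := by
      simp
    _ ≤ ENNReal.ofReal N⁻¹ * ENNReal.ofReal (S ^ 2) * ENNReal.ofReal (N * K ^ 2) :=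
      mul_le_mul_right hvol _
    _ = ENNReal.ofReal ((K * S) ^ 2) := by
      rw [← ENNReal.ofReal_mul (inv_pos.2 hN).le, ← ENNReal.ofReal_mul (by positivity)]
      congr 1
      field_simp

end Oscillation

end HatFE

namespace HatFE

/-! ### One-dimensional profiles: box and hat -/

section Profile

/-- A nonnegative function supported in `[-1, 1)` whose integer translates sum up to one. -/
structure IsProfile (q : ℝ → ℝ) : Prop where
  measurable : Measurable q
  nonneg : ∀ u, 0 ≤ q u
  mem_of_ne_zero : ∀ u, q u ≠ 0 → -1 ≤ u ∧ u < 1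
  add_eq_one : ∀ u, 0 ≤ u → u < 1 → q u + q (u - 1) = 1

/-- The indicator function of `[0, 1)`. -/
noncomputable def box : ℝ → ℝ := (Set.Ico (0 : ℝ) 1).indicator 1

theorem isProfile_box : IsProfile box where
  measurable := measurable_one.indicator measurableSet_Ico
  nonneg u := Set.indicator_nonneg (fun _ _ => zero_le_one) u
  mem_of_ne_zero u hu := by
    have := Set.mem_of_indicator_ne_zero hu
    exact ⟨by linarith [this.1], this.2⟩
  add_eq_one u h0 h1 := by
    have hm : u ∈ Set.Ico (0 : ℝ) 1 := ⟨h0, h1⟩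
    have hn : u - 1 ∉ Set.Ico (0 : ℝ) 1 := fun h => by linarith [h.1]
    rw [box, Set.indicator_of_mem hm, Set.indicator_of_notMem hn, Pi.one_apply, add_zero]

theorem isProfile_chi : IsProfile chi where
  measurable := by unfold chi; fun_prop
  nonneg u := le_max_left _ _
  mem_of_ne_zero u hu := by
    have h : |u| < 1 := by
      by_contra h
      exact hu (max_eq_left (by linarith))
    exact ⟨(abs_lt.1 h).1.le, (abs_lt.1 h).2⟩
  add_eq_one u h0 h1 := by
    rw [chi, chi, abs_of_nonneg h0, abs_of_neg (by linarith), max_eq_right (by linarith),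
      max_eq_right (by linarith)]
    ring

namespace IsProfile

variable {q : ℝ → ℝ}

theorem le_one (h : IsProfile q) (u : ℝ) : q u ≤ 1 := by
  by_cases hu : q u = 0
  · rw [hu]; exact zero_le_one
  · have hm := h.mem_of_ne_zero u hu
    rcases le_or_gt 0 u with h0 | h0
    · linarith [h.add_eq_one u h0 hm.2, h.nonneg (u - 1)]
    · have := h.add_eq_one (u + 1) (by linarith) (by linarith)
      rw [add_sub_cancel_right] at this
      linarith [h.nonneg (u + 1)]

theorem intervalIntegrable (h : IsProfile q) (a b : ℝ) : IntervalIntegrable q volume a b := by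
  refine (intervalIntegrable_const (c := (1 : ℝ))).mono_fun h.measurable.aestronglyMeasurable
    (ae_of_all _ fun u => ?_)
  simpa [abs_of_nonneg (h.nonneg u)] using h.le_one u

/-- Moving the part over `[-1, 0)` by one folds the integral into that of `q u + q (u - 1) = 1` over
`[0, 1)`. -/
theorem integral_eq_one (h : IsProfile q) : ∫ u, q u = 1 := by
  have h1 : ∫ u, q u = ∫ u in Set.Ico (-1 : ℝ) 1, q u :=
    (setIntegral_eq_integral_of_forall_compl_eq_zero fun u hu => by
      by_contra h0
      exact hu (h.mem_of_ne_zero u h0)).symm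
  have h2 : ∫ u in (-1 : ℝ)..0, q u = ∫ u in (0 : ℝ)..1, q (u - 1) := by
    rw [intervalIntegral.integral_comp_sub_right]
    norm_num
  have h3 : IntervalIntegrable (fun u => q (u - 1)) volume 0 1 := by
    simpa using (h.intervalIntegrable (0 - 1) (1 - 1)).comp_sub_right 1
  rw [h1, integral_Ico_eq_integral_Ioc, ← intervalIntegral.integral_of_le (by norm_num),
    ← intervalIntegral.integral_add_adjacent_intervals (h.intervalIntegrable (-1) 0)
      (h.intervalIntegrable 0 1), h2, ← intervalIntegral.integral_add h3 (h.intervalIntegrable 0 1)]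
  rw [intervalIntegral.integral_of_le zero_le_one, ← integral_Ico_eq_integral_Ioc,
    setIntegral_congr_fun (g := fun _ => (1 : ℝ)) measurableSet_Ico fun u hu => by
      rw [add_comm]; exact h.add_eq_one u hu.1 hu.2]
  simp

theorem eq_zero_of_notMem (h : IsProfile q) (t : ℝ) {l : ℤ}
    (hl : l ∉ ({⌊t⌋, ⌊t⌋ + 1} : Finset ℤ)) : q (t - l) = 0 := by
  by_contra h0
  have hm := h.mem_of_ne_zero _ h0
  have h1 : ⌊t⌋ ≤ l := by
    refine Int.floor_le_iff.2 ?_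
    linarith [hm.2]
  have h2 : l - 1 ≤ ⌊t⌋ := by
    refine Int.le_floor.2 ?_
    push_cast
    linarith [hm.1]
  simp only [Finset.mem_insert, Finset.mem_singleton, not_or] at hl
  omega

theorem sum_eq_one (h : IsProfile q) (t : ℝ) :
    ∑ l ∈ ({⌊t⌋, ⌊t⌋ + 1} : Finset ℤ), q (t - l) = 1 := by
  rw [Finset.sum_pair (by omega), ← h.add_eq_one (Int.fract t) (Int.fract_nonneg t)
    (Int.fract_lt_one t), Int.fract]
  push_cast
  rw [sub_sub]

theorem integral_comp_affine (h : IsProfile q) (c : ℝ) {s : ℝ} (hs : 0 < s) (l : ℤ) :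
    ∫ x, q ((x - c) / s - l) = s := by
  have h1 : ∀ x : ℝ, q ((x - c) / s - l) = q ((x - (c + s * l)) / s) := fun x => by
    congr 1; field_simp; ring
  simp only [h1]
  rw [integral_sub_right_eq_self (fun x => q (x / s)), Measure.integral_comp_div,
    h.integral_eq_one, abs_of_pos hs, smul_eq_mul, mul_one]

end IsProfile

/-- The hat function is a moving average of the box function. -/
theorem chi_eq_integral_box (t : ℝ) : ∫ σ in Set.Ioc (0 : ℝ) 1, box (t + σ) = chi t := by
  have h1 : ∀ σ, box (t + σ) = (Set.Ico (-t) (1 - t)).indicator 1 σ := fun σ => by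
    have : t + σ ∈ Set.Ico (0 : ℝ) 1 ↔ σ ∈ Set.Ico (-t) (1 - t) := by
      constructor <;> rintro ⟨h, h'⟩ <;> constructor <;> linarith
    by_cases h : t + σ ∈ Set.Ico (0 : ℝ) 1
    · rw [box, Set.indicator_of_mem h, Set.indicator_of_mem (this.1 h)]; rfl
    · rw [box, Set.indicator_of_notMem h, Set.indicator_of_notMem (mt this.2 h)]
  simp only [h1]
  rw [integral_indicator_one measurableSet_Ico, measureReal_restrict_apply measurableSet_Ico]
  rcases le_or_gt 0 t with h | h
  · have : Set.Ico (-t) (1 - t) ∩ Set.Ioc 0 1 = Set.Ioo 0 (1 - t) := by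
      ext σ
      simp only [Set.mem_inter_iff, Set.mem_Ico, Set.mem_Ioc, Set.mem_Ioo]
      constructor
      · rintro ⟨⟨_, _⟩, _, _⟩; constructor <;> linarith
      · rintro ⟨_, _⟩; refine ⟨⟨?_, ?_⟩, ?_, ?_⟩ <;> linarith
    rw [this, measureReal_def, Real.volume_Ioo, ENNReal.toReal_ofReal', chi, abs_of_nonneg h,
      max_comm, sub_zero]
  · have : Set.Ico (-t) (1 - t) ∩ Set.Ioc 0 1 = Set.Icc (-t) 1 := by
      ext σ
      simp only [Set.mem_inter_iff, Set.mem_Ico, Set.mem_Ioc, Set.mem_Icc]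
      constructor
      · rintro ⟨⟨_, _⟩, _, _⟩; constructor <;> linarith
      · rintro ⟨_, _⟩; refine ⟨⟨?_, ?_⟩, ?_, ?_⟩ <;> linarith
    rw [this, measureReal_def, Real.volume_Icc, ENNReal.toReal_ofReal', chi, abs_of_neg h,
      max_comm]

end Profile

/-! ### Tensor products of profiles and the derivative of the approximation -/

section Tensor

variable {d : ℕ}

/-- The tensor product of profiles, centered at the knot `c + s l` and scaled by `s`. -/
noncomputable def tensor (q : Fin d → ℝ → ℝ) (c s : Fin d → ℝ) (l : Fin d → ℤ) : Space d → ℝ :=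
  fun x => ∏ i, q i ((x i - c i) / s i - l i)

variable {q : Fin d → ℝ → ℝ} {c s : Fin d → ℝ}

theorem integral_tensor (hq : ∀ i, IsProfile (q i)) (hs : ∀ i, 0 < s i) (l : Fin d → ℤ) :
    ∫ x, tensor q c s l x = ∏ i, s i := by
  rw [← (PiLp.volume_preserving_toLp (Fin d)).integral_comp
    (MeasurableEquiv.toLp 2 (Fin d → ℝ)).measurableEmbedding]
  simp only [tensor]
  rw [integral_fintype_prod_volume_eq_prod (f := fun i (y : ℝ) => q i ((y - c i) / s i - l i))]
  exact Finset.prod_congr rfl fun i _ => (hq i).integral_comp_affine (c i) (hs i) (l i)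

theorem hasSum_tensor (hq : ∀ i, IsProfile (q i)) (x : Space d) :
    HasSum (fun l => tensor q c s l x) 1 := by
  classical
  let t : Fin d → ℝ := fun i => (x i - c i) / s i
  have h1 : (1 : ℝ) = ∑ l ∈ Fintype.piFinset fun i => ({⌊t i⌋, ⌊t i⌋ + 1} : Finset ℤ),
      tensor q c s l x := by
    simp only [tensor]
    rw [← Finset.prod_univ_sum (fun i => ({⌊t i⌋, ⌊t i⌋ + 1} : Finset ℤ))
      (fun i (k : ℤ) => q i (t i - k))]
    exact (Finset.prod_eq_one fun i _ => (hq i).sum_eq_one (t i)).symm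
  rw [h1]
  refine hasSum_sum_of_ne_finset_zero fun l hl => ?_
  rw [Fintype.mem_piFinset, not_forall] at hl
  obtain ⟨i, hi⟩ := hl
  exact Finset.prod_eq_zero (Finset.mem_univ i) ((hq i).eq_zero_of_notMem (t i) hi)

theorem isPartition_tensor (hq : ∀ i, IsProfile (q i)) (hs : ∀ i, 0 < s i) :
    IsPartition (tensor q c s) (∏ i, s i) where
  measurable l := by
    unfold tensor
    refine Finset.measurable_prod _ fun i _ => (hq i).measurable.comp ?_
    fun_prop
  nonneg l x := Finset.prod_nonneg fun i _ => (hq i).nonneg _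
  integrable l := by
    -- The Bochner integral of a non-integrable function is zero by convention, so a positive
    -- integral already proves integrability.
    refine Integrable.of_integral_ne_zero ?_
    rw [integral_tensor hq hs]
    exact (Finset.prod_pos fun i _ => hs i).ne'
  integral_eq l := integral_tensor hq hs l
  hasSum_one x := hasSum_tensor hq x

theorem norm_le_sum_abs (w : Space d) : ‖w‖ ≤ ∑ i, |w i| := by
  rw [EuclideanSpace.norm_eq]
  refine Real.sqrt_le_iff.2 ⟨Finset.sum_nonneg fun i _ => abs_nonneg _, ?_⟩
  exact Finset.sum_sq_le_sq_sum_of_nonneg fun i _ => abs_nonneg _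

theorem norm_sub_le_of_tensor_ne_zero {q' : Fin d → ℝ → ℝ} (hq : ∀ i, IsProfile (q i))
    (hq' : ∀ i, IsProfile (q' i)) (hs : ∀ i, 0 < s i) (l : Fin d → ℤ) (x y : Space d)
    (hx : tensor q c s l x ≠ 0) (hy : tensor q' c s l y ≠ 0) : ‖y - x‖ ≤ 2 * ∑ i, s i := by
  refine (norm_le_sum_abs _).trans ?_
  rw [Finset.mul_sum]
  refine Finset.sum_le_sum fun i _ => ?_
  have h1 := (hq i).mem_of_ne_zero _ (Finset.prod_ne_zero_iff.1 hx i (Finset.mem_univ i))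
  have h2 := (hq' i).mem_of_ne_zero _ (Finset.prod_ne_zero_iff.1 hy i (Finset.mem_univ i))
  have h3 : y i - x i = s i * (((y i - c i) / s i - l i) - ((x i - c i) / s i - l i)) := by
    have := (hs i).ne'
    field_simp
    ring
  rw [PiLp.sub_apply, h3, abs_mul, abs_of_pos (hs i), mul_comm]
  refine mul_le_mul_of_nonneg_right (abs_le.2 ⟨?_, ?_⟩) (hs i).le <;>
    linarith [h1.1, h1.2, h2.1, h2.2]

/-- Translation by one grid spacing is a shift of the index; this is what allows summation by parts
over the grid. -/
theorem tensor_add_single (hs : ∀ i, 0 < s i) (l : Fin d → ℤ) (i : Fin d) (x : Space d) :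
    tensor q c s l (x + EuclideanSpace.single i (s i)) = tensor q c s (l - Pi.single i 1) x := by
  refine Finset.prod_congr rfl fun j _ => ?_
  congr 1
  have := (hs j).ne'
  by_cases hj : j = i
  · subst hj
    simp
    field_simp
    ring
  · simp [hj]

theorem isProfile_update_box (i j : Fin d) :
    IsProfile (Function.update (fun _ => chi) i box j) := by
  by_cases hj : j = i
  · subst hj; simpa using isProfile_box
  · simpa [hj] using isProfile_chi

/-- The tensor product of hat functions is an average of tensor products with one box factor. -/
theorem integral_tensor_update_box (hs : ∀ i, 0 < s i) (l : Fin d → ℤ) (i : Fin d) (x : Space d) :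
    ∫ σ in Set.Ioc (0 : ℝ) 1, tensor (Function.update (fun _ => chi) i box) c s l
      (x + σ • EuclideanSpace.single i (s i)) = tensor (fun _ => chi) c s l x := by
  have h1 : ∀ σ : ℝ, tensor (Function.update (fun _ => chi) i box) c s l
      (x + σ • EuclideanSpace.single i (s i)) = box ((x i - c i) / s i - l i + σ) *
        ∏ j ∈ Finset.univ.erase i, chi ((x j - c j) / s j - l j) := fun σ => by
    rw [tensor, ← Finset.mul_prod_erase _ _ (Finset.mem_univ i)]
    congr 1
    · have := (hs i).ne'
      simp
      congr 1
      field_simp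
      ring
    · refine Finset.prod_congr rfl fun j hj => ?_
      have hj' := Finset.ne_of_mem_erase hj
      simp [hj']
  simp only [h1]
  rw [integral_mul_const, chi_eq_integral_box, tensor,
    ← Finset.mul_prod_erase _ _ (Finset.mem_univ i)]

theorem ip_eq_pairing_lineMeasure {f g φ : Space d → ℝ} (hf : MemLp f 2 volume)
    (hφ : MemLp φ 2 volume) (w : Space d)
    (hg : ∀ x, ∫ σ in Set.Ioc (0 : ℝ) 1, f (x + σ • w) = g x) :
    ip g φ = ∫ p, f p.2 * φ p.1 ∂(lineMeasure w) := by
  have h1 := (isCoupling_lineMeasure w).integrable_pairing hf hφ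
  rw [lineMeasure] at h1 ⊢
  have h2 := h1.comp_measurable (measurable_line w)
  simp only [Function.comp_def] at h2
  rw [integral_map (measurable_line w).aemeasurable h1.1, integral_prod_symm _ h2]
  simp only [ip, integral_mul_const, hg]

/-- The weak partial derivatives of the approximations. -/
theorem hasWeakPartial_gridOp (hs : ∀ i, 0 < s i) {u : Space d → ℝ} (hu : MemLp u 2 volume)
    (i : Fin d) :
    HasWeakPartial i
      (gridOp (tensor (fun _ => chi) c s) (tensor (fun _ => chi) c s) (∏ i, s i) u)
      (gridOp (tensor (Function.update (fun _ => chi) i box) c s) (tensor (fun _ => chi) c s)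
        (∏ i, s i) (finDiff s u i)) := by
  intro φ hφ hc
  have hd := memLp_partial hφ hc (EuclideanSpace.single i 1)
  have hφ2 := memLp_of_test hφ hc
  set N := ∏ i, s i
  set w : Space d := EuclideanSpace.single i (s i) with hw
  set e : Fin d → ℤ := Pi.single i 1
  have hN : 0 < N := Finset.prod_pos fun i _ => hs i
  have hψ : IsPartition (tensor (fun _ => chi) c s) N :=
    isPartition_tensor (fun _ => isProfile_chi) hs
  have hθ : IsPartition (tensor (Function.update (fun _ => chi) i box) c s) N :=
    isPartition_tensor (isProfile_update_box i) hs
  have havg := integral_tensor_update_box (c := c) hs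
  have hsh := tensor_add_single (q := Function.update (fun _ => chi) i box) (c := c) hs
  have hsh' := tensor_add_single (q := fun _ => chi) (c := c) hs
  set ψ := tensor (fun _ => chi) c s
  set θ := tensor (Function.update (fun _ => chi) i box) c s
  have hu' := memLp_shift hu w
  -- As `ψ_l` is the segment average of `θ_l`, its weak derivative is the difference quotient of
  -- `θ_l`, that is, a difference of neighbouring `θ`.
  have k1 : ∀ l, ip (ψ l) (fun x => fderiv ℝ φ x (EuclideanSpace.single i 1)) =
      -(s i)⁻¹ * (ip (θ (l - e)) φ - ip (θ l) φ) := fun l => by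
    rw [ip_eq_pairing_lineMeasure (hθ.memLp_two l) hd w (havg l i),
      ← neg_neg (∫ p, _ ∂_), ← ip_finDiff_eq_neg_pairing (hθ.memLp_two l) hφ hc s i (hs i).ne',
      neg_mul, neg_inj]
    simp only [ip, finDiff, hsh, mul_assoc]
    rw [integral_const_mul]
    simp only [sub_mul]
    rw [integral_sub (integrable_mul_of_memLp_two (hθ.memLp_two _) hφ2)
      (integrable_mul_of_memLp_two (hθ.memLp_two _) hφ2)]
  have k2 : ∀ l, ip (ψ (l - e)) (shift w u) = ip (ψ l) u := fun l => by
    rw [ip_comm, ← integral_mul_sub_const, ip]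
    refine integral_congr_ae (ae_of_all _ fun x => ?_)
    have := hsh' l i (x - w)
    rw [hw, sub_add_cancel, ← hw] at this
    change u x * ψ (l - e) (x - w) = ψ l x * u x
    rw [this, mul_comm]
  have k3 : ∀ l, ip (ψ l) (finDiff s u i) = (s i)⁻¹ * (ip (ψ l) (shift w u) - ip (ψ l) u) :=
    fun l => by
    have := integral_sub (integrable_mul_of_memLp_two (hψ.memLp_two l) hu')
      (integrable_mul_of_memLp_two (hψ.memLp_two l) hu)
    simp only [ip]
    rw [← this, ← integral_const_mul]
    refine integral_congr_ae (ae_of_all _ fun x => ?_)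
    simp only [finDiff, shift]
    ring
  have H1 := hasSum_ip_gridOp hN hψ hψ hu hd
  have H2 := hasSum_ip_gridOp hN hθ hψ hu hφ2
  have H3 := hasSum_ip_gridOp hN hθ hψ hu' hφ2
  have H4 := hasSum_ip_gridOp hN hθ hψ (memLp_finDiff hu s i) hφ2
  -- Summation by parts: reindexing by `l ↦ l - e` and using `k2` transfers the difference from
  -- `θ_l` to the coefficients, where `k3` recognises the difference quotient of `u`.
  have H3' := (Equiv.subRight e).hasSum_iff.2 H3
  simp only [Function.comp_def, Equiv.subRight_apply, k2] at H3'
  have e4 : (fun l => N⁻¹ * ip (ψ l) (finDiff s u i) * ip (θ l) φ) = fun l => (s i)⁻¹ *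
      (N⁻¹ * ip (ψ l) (shift w u) * ip (θ l) φ - N⁻¹ * ip (ψ l) u * ip (θ l) φ) :=
    funext fun l => by rw [k3]; ring
  have e1 : (fun l => N⁻¹ * ip (ψ l) u *
      ip (ψ l) (fun x => fderiv ℝ φ x (EuclideanSpace.single i 1))) = fun l => -(s i)⁻¹ *
      (N⁻¹ * ip (ψ l) u * ip (θ (l - e)) φ - N⁻¹ * ip (ψ l) u * ip (θ l) φ) :=
    funext fun l => by rw [k1]; ring
  rw [e4] at H4
  rw [e1] at H1
  have E4 := H4.unique ((H3.sub H2).mul_left (s i)⁻¹)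
  have E1 := H1.unique ((H3'.sub H2).mul_left (-(s i)⁻¹))
  change ip _ (fun x => fderiv ℝ φ x (EuclideanSpace.single i 1)) = -ip _ φ
  rw [E1, E4]
  ring

end Tensor

end HatFE

namespace HatFE

variable {d : ℕ}

/-! ### Uniqueness of weak derivatives -/

section WeakGradient

theorem HasWeakPartial.ae_eq {i : Fin d} {u g g' : Space d → ℝ} (hg : MemLp g 2 volume)
    (hg' : MemLp g' 2 volume) (h : HasWeakPartial i u g) (h' : HasWeakPartial i u g') :
    g =ᵐ[volume] g' :=
  ae_eq_of_test (hg.locallyIntegrable (by norm_num)) (hg'.locallyIntegrable (by norm_num))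
    fun φ h1 h2 => neg_injective ((h φ h1 h2).symm.trans (h' φ h1 h2))

theorem ip_congr_ae {f f' g g' : Space d → ℝ} (hf : f =ᵐ[volume] f') (hg : g =ᵐ[volume] g') :
    ip f g = ip f' g' := by
  refine integral_congr_ae ?_
  filter_upwards [hf, hg] with x h1 h2
  rw [h1, h2]

end WeakGradient

/-! ### Components of vector fields and suprema over translations -/

section VectorFields

theorem norm2_le_vecNorm2 (U : Fin d → Space d → ℝ) (i : Fin d) : norm2 (U i) ≤ vecNorm2 U :=
  Real.le_sqrt_of_sq_le
    (Finset.single_le_sum (f := fun i => norm2 (U i) ^ 2) (fun _ _ => sq_nonneg _)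
      (Finset.mem_univ i))

theorem Gam_le_vecGam (w : Space d) (U : Fin d → Space d → ℝ) (i : Fin d) :
    Gam w (U i) ≤ vecGam w U := norm2_le_vecNorm2 (fun i => shift w (U i) - U i) i

/-- The bound `2 ‖u‖` is needed because an unbounded real supremum has the default value zero. -/
theorem Gam_le_iSup {u : Space d → ℝ} (hu : MemLp u 2 volume) (B : Set (Space d)) {w : Space d}
    (hw : w ∈ B) : Gam w u ≤ ⨆ w : B, Gam w.1 u := by
  refine le_ciSup (f := fun w : B => Gam w.1 u) ⟨2 * norm2 u, ?_⟩ ⟨w, hw⟩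
  rintro _ ⟨z, rfl⟩
  exact Gam_le_two_mul hu _

theorem vecGam_le_iSup {U : Fin d → Space d → ℝ} (hU : ∀ i, MemLp (U i) 2 volume)
    (B : Set (Space d)) {w : Space d} (hw : w ∈ B) : vecGam w U ≤ ⨆ w : B, vecGam w.1 U := by
  refine le_ciSup (f := fun w : B => vecGam w.1 U)
    ⟨Real.sqrt (∑ i, (2 * norm2 (U i)) ^ 2), ?_⟩ ⟨w, hw⟩
  rintro _ ⟨z, rfl⟩
  refine Real.sqrt_le_sqrt (Finset.sum_le_sum fun i _ => ?_)
  exact pow_le_pow_left₀ (norm2_nonneg _) (Gam_le_two_mul (hU i) z.1) 2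

end VectorFields

/-! ### From the ball to the sphere -/

section Sphere

/-- In dimension at least two, every vector of a ball is a sum of two vectors of the sphere. -/
theorem exists_add_eq_of_norm_le (hd : 2 ≤ d) {h : ℝ} (hh : 0 ≤ h) {w : Space d} (hw : ‖w‖ ≤ h) :
    ∃ a b : Space d, ‖a‖ = h ∧ ‖b‖ = h ∧ a + b = w := by
  obtain ⟨e, he, he0⟩ : ∃ e : Space d, inner ℝ w e = 0 ∧ e ≠ 0 := by
    have hne : (Submodule.span ℝ {w})ᗮ ≠ ⊥ := by
      intro h0
      rw [Submodule.orthogonal_eq_bot_iff] at h0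
      have h1 := finrank_span_le_card (R := ℝ) ({w} : Set (Space d))
      rw [h0, finrank_top, finrank_euclideanSpace_fin, Set.toFinset_singleton,
        Finset.card_singleton] at h1
      omega
    obtain ⟨e, he, he0⟩ := Submodule.exists_mem_ne_zero_of_ne_bot hne
    exact ⟨e, Submodule.mem_orthogonal_singleton_iff_inner_right.1 he, he0⟩
  have hne : ‖e‖ ≠ 0 := norm_ne_zero_iff.2 he0
  -- By Pythagoras, `w/2 ± ρ e/‖e‖` with `e` orthogonal to `w` both have length `h`, and their sum
  -- is `w`.
  set ρ := Real.sqrt (h ^ 2 - ‖w‖ ^ 2 / 4)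
  have hρ : ρ ^ 2 = h ^ 2 - ‖w‖ ^ 2 / 4 := Real.sq_sqrt (by nlinarith [norm_nonneg w])
  have key : ∀ τ : ℝ, τ ^ 2 = ρ ^ 2 → ‖(2⁻¹ : ℝ) • w + (τ * ‖e‖⁻¹) • e‖ = h := by
    intro τ hτ
    have h1 := norm_add_sq_eq_norm_sq_add_norm_sq_real
      (x := (2⁻¹ : ℝ) • w) (y := (τ * ‖e‖⁻¹) • e) (by simp [inner_smul_left, inner_smul_right, he])
    have h2 : ‖(τ * ‖e‖⁻¹) • e‖ * ‖(τ * ‖e‖⁻¹) • e‖ = τ ^ 2 := by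
      rw [norm_smul, norm_mul, norm_inv, norm_norm, inv_mul_cancel_right₀ hne,
        Real.norm_eq_abs, abs_mul_abs_self, sq]
    have h3 : ‖(2⁻¹ : ℝ) • w‖ = 2⁻¹ * ‖w‖ := by rw [norm_smul]; norm_num
    rw [h2, h3, hτ, hρ] at h1
    refine (sq_eq_sq₀ (norm_nonneg _) hh).1 ?_
    rw [sq, h1]
    ring
  refine ⟨_, _, key ρ rfl, key (-ρ) (neg_sq ρ), ?_⟩
  module

/-- In dimension at least two, translations in the ball are controlled by those in the sphere. -/
theorem Gam_le_two_mul_of_sphere (hd : 2 ≤ d) {h S : ℝ} (hh : 0 ≤ h) {u : Space d → ℝ}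
    (hu : MemLp u 2 volume) (hS : ∀ w : Space d, ‖w‖ = h → Gam w u ≤ S) {w : Space d}
    (hw : ‖w‖ ≤ h) : Gam w u ≤ 2 * S := by
  obtain ⟨a, b, ha, hb, rfl⟩ := exists_add_eq_of_norm_le hd hh hw
  linarith [Gam_add_le hu a b, hS a ha, hS b hb]

/-- Translations of a partial derivative in the ball are controlled by those in the sphere and by
the error of the difference quotients. -/
theorem Gam_weakGrad_le {h : ℝ} (hh : 0 < h) {u : Space d → ℝ} (hu : MemW12 u) (t : Fin d → ℝ)
    (k : Fin d → ℕ) (hk : ∀ i, 0 < k i) (ht : ∀ i, t i = h * k i) (i : Fin d) {w : Space d}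
    (hw : ‖w‖ ≤ h) : Gam w (weakGrad u i) ≤ 2 * (vecNorm2 (fun i => weakGrad u i - finDiff t u i) +
      ⨆ w : Metric.sphere (0 : Space d) h, vecGam w.1 (weakGrad u)) := by
  have hg := fun i => (weakGrad_spec hu i).1
  have hE := norm2_le_vecNorm2 (fun i => weakGrad u i - finDiff t u i) i
  have hE0 := norm2_nonneg (weakGrad u i - finDiff t u i)
  have hS : ∀ z : Space d, ‖z‖ = h → Gam z (weakGrad u i) ≤
      ⨆ w : Metric.sphere (0 : Space d) h, vecGam w.1 (weakGrad u) := fun z hz =>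
    (Gam_le_vecGam z _ i).trans (vecGam_le_iSup hg _ (by simpa using hz))
  rcases Nat.lt_or_ge 1 d with hd | hd
  · linarith [Gam_le_two_mul_of_sphere hd hh.le (hg i) hS hw]
  -- In dimension one the sphere has only two points, and every translation is in the direction of
  -- the difference quotient.
  · have hw' : w = EuclideanSpace.single i (w i) := by
      ext j
      have : j = i := by
        have := i.2; have := j.2; ext; omega
      subst this
      simp
    have hwi : |w i| ≤ h := by
      rw [hw'] at hw
      simpa using hw
    have h1 := Gam_single_le hu.1 (hg i) (weakGrad_spec hu i).2 t hh (hk i) (ht i) hwi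
    rw [← hw'] at h1
    have h2 := hS (EuclideanSpace.single i h) (by simp [abs_of_pos hh])
    have h3 := Gam_nonneg (EuclideanSpace.single i h) (weakGrad u i)
    linarith

end Sphere

/-! ### Estimates for the hat function approximations -/

section HatApprox

variable {r : Fin d → ℕ}

theorem step_pos (n : ℕ) : 0 < step n := by unfold step; positivity

theorem psi_eq_tensor {h : ℝ} (hh : 0 < h) (hr : ∀ i, 1 ≤ r i) (m l : Fin d → ℤ) :
    psi r h (fun i => m i + l i * r i) =
      tensor (fun _ => chi) (fun i => h * m i) (fun i => h * r i) l := by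
  ext x
  refine Finset.prod_congr rfl fun i _ => ?_
  have h1 : (0 : ℝ) < r i := by exact_mod_cast hr i
  congr 1
  push_cast
  field_simp
  ring

theorem lpNorm_one_tensor {q : Fin d → ℝ → ℝ} {c s : Fin d → ℝ} (hq : ∀ i, IsProfile (q i))
    (hs : ∀ i, 0 < s i) (l : Fin d → ℤ) :
    lpNorm (tensor q c s l) 1 volume = ∏ i, s i := by
  have hp := isPartition_tensor (c := c) hq hs
  rw [lpNorm_one_eq_integral_norm (hp.measurable l).aestronglyMeasurable, ← hp.integral_eq l]
  simp only [Real.norm_of_nonneg (hp.nonneg l _)]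

theorem hatApprox_eq_gridOp (hr : ∀ i, 1 ≤ r i) (m : Fin d → ℤ) (n : ℕ) (u : Space d → ℝ) :
    hatApprox r m n u =
      gridOp (tensor (fun _ => chi) (fun i => step n * m i) (fun i => step n * r i))
        (tensor (fun _ => chi) (fun i => step n * m i) (fun i => step n * r i))
        (∏ i, step n * r i) u := by
  have hs : ∀ i, 0 < step n * r i := fun i =>
    mul_pos (step_pos n) (by exact_mod_cast hr i)
  let e : (Fin d → ℤ) → subgridIndex r m := fun l => ⟨fun i => m i + l i * r i, l, fun _ => rfl⟩
  have he : Function.Bijective e := by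
    constructor
    · intro l l' h
      ext i
      have h1 := congrFun (congrArg Subtype.val h) i
      have h2 : r i ≠ 0 := by have := hr i; omega
      simpa [e, h2] using h1
    · rintro ⟨k, l, hl⟩
      exact ⟨l, Subtype.ext (funext fun i => (hl i).symm)⟩
  ext x
  rw [hatApprox, ← (Equiv.ofBijective e he).tsum_eq, gridOp]
  refine tsum_congr fun l => ?_
  have h1 : psi r (step n) (e l).1 =
      tensor (fun _ => chi) (fun i => step n * m i) (fun i => step n * r i) l :=
    psi_eq_tensor (step_pos n) hr m l
  rw [Equiv.ofBijective_apply, h1, lpNorm_one_tensor (fun _ => isProfile_chi) hs]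

/-- The factor by which the radius of the supports exceeds the grid step. -/
def reach (r : Fin d → ℕ) : ℕ := 2 * ∑ i, r i

/-- The constant bounding the grid oscillation by translations. -/
noncomputable def oscConst (r : Fin d → ℕ) : ℝ :=
  ((reach r : ℝ) ^ d * volume.real (Metric.ball (0 : Space d) 1) + 1) * reach r

theorem reach_pos (hd : 1 ≤ d) (hr : ∀ i, 1 ≤ r i) : 0 < reach r := by
  have := Finset.single_le_sum (f := r) (fun _ _ => Nat.zero_le _) (Finset.mem_univ ⟨0, hd⟩)
  have := hr ⟨0, hd⟩
  unfold reach
  omega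

theorem reach_le_oscConst : (reach r : ℝ) ≤ oscConst r := by
  unfold oscConst
  exact le_mul_of_one_le_left (by positivity) (le_add_of_nonneg_left (by positivity))

theorem oscConst_pos (hd : 1 ≤ d) (hr : ∀ i, 1 ≤ r i) : 0 < oscConst r :=
  lt_of_lt_of_le (by exact_mod_cast reach_pos hd hr) reach_le_oscConst

/-- The volume is `h^d` times a constant and `h^d ≤ ∏ h r_i`, as all `r_i ≥ 1`. The summand `1`
makes the base at least one, hence at most its square, which is the form required by
`osc_gridMeasure_le`. -/
theorem volume_closedBall_le {h : ℝ} (hh : 0 < h) (hr : ∀ i, 1 ≤ r i) :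
    volume (Metric.closedBall (0 : Space d) (reach r * h)) ≤ ENNReal.ofReal ((∏ i, h * r i) *
      ((reach r : ℝ) ^ d * volume.real (Metric.ball (0 : Space d) 1) + 1) ^ 2) := by
  set V := volume.real (Metric.ball (0 : Space d) 1)
  have hV : volume (Metric.ball (0 : Space d) 1) = ENNReal.ofReal V :=
    (ENNReal.ofReal_toReal measure_ball_lt_top.ne).symm
  have hV0 : 0 ≤ V := measureReal_nonneg
  rw [Measure.addHaar_closedBall _ _ (by positivity), finrank_euclideanSpace_fin, hV,
    ← ENNReal.ofReal_mul (by positivity)]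
  refine ENNReal.ofReal_le_ofReal ?_
  set K := (reach r : ℝ) ^ d * V + 1
  have hK : 1 ≤ K := le_add_of_nonneg_left (by positivity)
  have h1 : h ^ d ≤ ∏ i, h * r i := by
    rw [Finset.prod_mul_distrib, Finset.prod_const, Finset.card_univ, Fintype.card_fin]
    refine le_mul_of_one_le_right (by positivity) ?_
    exact Finset.one_le_prod fun i _ => by exact_mod_cast hr i
  calc (reach r * h) ^ d * V = h ^ d * ((reach r : ℝ) ^ d * V) := by rw [mul_pow]; ring
    _ ≤ h ^ d * K ^ 2 := by
      refine mul_le_mul_of_nonneg_left ?_ (by positivity)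
      have : K ≤ K ^ 2 := le_self_pow₀ hK (by norm_num)
      exact (le_add_of_nonneg_right zero_le_one).trans this
    _ ≤ _ := mul_le_mul_of_nonneg_right h1 (by positivity)

theorem osc_tensor_le (hd : 1 ≤ d) (hr : ∀ i, 1 ≤ r i) {h : ℝ} (hh : 0 < h)
    {q q' : Fin d → ℝ → ℝ} (hq : ∀ i, IsProfile (q i)) (hq' : ∀ i, IsProfile (q' i))
    (c : Fin d → ℝ) {f : Space d → ℝ} (hf : MemLp f 2 volume) {S : ℝ}
    (hS : ∀ w : Space d, ‖w‖ ≤ h → Gam w f ≤ S) :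
    osc (gridMeasure (tensor q c fun i => h * r i) (tensor q' c fun i => h * r i)
      (∏ i, h * r i)) f ≤ oscConst r * S := by
  have hs : ∀ i, 0 < h * r i := fun i => mul_pos hh (by exact_mod_cast hr i)
  have hS0 : 0 ≤ S := (Gam_nonneg _ _).trans (hS 0 (by simpa using hh.le))
  have hsum : 2 * ∑ i, h * r i = reach r * h := by
    rw [← Finset.mul_sum, reach]
    push_cast
    ring
  rw [oscConst, mul_assoc]
  refine osc_gridMeasure_le (Finset.prod_pos fun i _ => hs i) (isPartition_tensor hq hs)
    (isPartition_tensor hq' hs) (fun l x y hx hy => ?_) (by positivity)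
    (volume_closedBall_le hh hr) hf (by positivity)
    fun w hw => Gam_le_of_norm_le_mul hf (reach_pos hd hr) hS hw
  rw [← hsum]
  exact norm_sub_le_of_tensor_ne_zero hq hq' hs l x y hx hy

theorem memW12_hatApprox (hr : ∀ i, 1 ≤ r i) (m : Fin d → ℤ) (n : ℕ) {u : Space d → ℝ}
    (hu : MemLp u 2 volume) : MemW12 (hatApprox r m n u) := by
  have hs : ∀ i, 0 < step n * r i := fun i => mul_pos (step_pos n) (by exact_mod_cast hr i)
  have hN := Finset.prod_pos fun i (_ : i ∈ Finset.univ) => hs i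
  have hψ := isPartition_tensor (c := fun i => step n * m i)
    (fun _ : Fin d => isProfile_chi) hs
  rw [hatApprox_eq_gridOp hr]
  refine ⟨(represents_gridOp hN hψ hψ hu).1, fun i => ⟨_, ?_, hasWeakPartial_gridOp hs hu i⟩⟩
  exact (represents_gridOp hN (isPartition_tensor (isProfile_update_box i) hs) hψ
    (memLp_finDiff hu _ i)).1

/-- Convergence of the `L²` scalar products. -/
theorem abs_ip_hatApprox_sub_le (hd : 1 ≤ d) (hr : ∀ i, 1 ≤ r i) (m : Fin d → ℤ) (n : ℕ)
    {v u : Space d → ℝ} (hv : MemLp v 2 volume) (hu : MemLp u 2 volume) {S : ℝ}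
    (hS : ∀ w : Space d, ‖w‖ ≤ step n → Gam w u ≤ S) :
    |ip (hatApprox r m n v) (hatApprox r m n u) - ip v u| ≤ 2 * (norm2 v * (oscConst r * S)) := by
  have hs : ∀ i, 0 < step n * r i := fun i => mul_pos (step_pos n) (by exact_mod_cast hr i)
  have hN := Finset.prod_pos fun i (_ : i ∈ Finset.univ) => hs i
  have hψ := isPartition_tensor (c := fun i => step n * m i)
    (fun _ : Fin d => isProfile_chi) hs
  rw [hatApprox_eq_gridOp hr, hatApprox_eq_gridOp hr]
  have h1 := (isCoupling_gridMeasure hN hψ hψ).abs_ip_sub_ip_le hv hu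
    (represents_gridOp hN hψ hψ hv) (represents_gridOp hN hψ hψ hu)
  have h2 := osc_tensor_le hd hr (step_pos n) (fun _ => isProfile_chi) (fun _ => isProfile_chi)
    (fun i => step n * m i) hu hS
  exact h1.trans (mul_le_mul_of_nonneg_left (mul_le_mul_of_nonneg_left h2 (norm2_nonneg v))
    zero_le_two)

/-- The chosen representative `weakGrad` is determined only almost everywhere; this suffices for
scalar products. -/
theorem weakGrad_hatApprox_ae_eq (hr : ∀ i, 1 ≤ r i) (m : Fin d → ℤ) (n : ℕ) {u : Space d → ℝ}
    (hu : MemLp u 2 volume) (i : Fin d) :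
    weakGrad (hatApprox r m n u) i =ᵐ[volume]
      gridOp (tensor (Function.update (fun _ => chi) i box) (fun i => step n * m i)
          fun i => step n * r i)
        (tensor (fun _ => chi) (fun i => step n * m i) fun i => step n * r i)
        (∏ i, step n * r i) (finDiff (fun i => step n * r i) u i) := by
  have hs : ∀ i, 0 < step n * r i := fun i => mul_pos (step_pos n) (by exact_mod_cast hr i)
  have hN := Finset.prod_pos fun i (_ : i ∈ Finset.univ) => hs i
  have hw := weakGrad_spec (memW12_hatApprox hr m n hu) i
  have h2 := hasWeakPartial_gridOp (c := fun i => step n * m i) hs hu i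
  rw [← hatApprox_eq_gridOp hr] at h2
  exact HasWeakPartial.ae_eq hw.1 (represents_gridOp hN
    (isPartition_tensor (isProfile_update_box i) hs)
    (isPartition_tensor (fun _ => isProfile_chi) hs) (memLp_finDiff hu _ i)).1 hw.2 h2

/-- Convergence of the scalar products of the partial derivatives. -/
theorem abs_ip_weakGrad_hatApprox_sub_le (hd : 1 ≤ d) (hr : ∀ i, 1 ≤ r i) (m : Fin d → ℤ) (n : ℕ)
    {v u : Space d → ℝ} (hv : MemW12 v) (hu : MemW12 u) (i : Fin d) {S : ℝ}
    (hS : ∀ w : Space d, ‖w‖ ≤ step n → Gam w (weakGrad u i) ≤ S) :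
    |ip (weakGrad (hatApprox r m n v) i) (weakGrad (hatApprox r m n u) i) -
      ip (weakGrad v i) (weakGrad u i)| ≤ 4 * (norm2 (weakGrad v i) * (oscConst r * S)) := by
  have hs : ∀ i, 0 < step n * r i := fun i => mul_pos (step_pos n) (by exact_mod_cast hr i)
  have hN := Finset.prod_pos fun i (_ : i ∈ Finset.univ) => hs i
  have hS0 : 0 ≤ S := (Gam_nonneg _ _).trans (hS 0 (by simpa using (step_pos n).le))
  have hψ := isPartition_tensor (c := fun i => step n * m i)
    (fun _ : Fin d => isProfile_chi) hs
  have hθ := isPartition_tensor (c := fun i => step n * m i) (isProfile_update_box i) hs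
  obtain ⟨hf, hfv⟩ := weakGrad_spec hv i
  obtain ⟨hg, hgu⟩ := weakGrad_spec hu i
  rw [ip_congr_ae (weakGrad_hatApprox_ae_eq hr m n hv.1 i) (weakGrad_hatApprox_ae_eq hr m n hu.1 i)]
  set s : Fin d → ℝ := fun i => step n * r i
  have hDv := memLp_finDiff hv.1 s i
  have hDu := memLp_finDiff hu.1 s i
  have hC := (oscConst_pos hd hr).le
  have h1 := (isCoupling_gridMeasure hN hθ hψ).abs_ip_sub_ip_le hDv hDu
    (represents_gridOp hN hθ hψ hDv) (represents_gridOp hN hθ hψ hDu)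
  have h2 := osc_tensor_le hd hr (step_pos n) (isProfile_update_box i) (fun _ => isProfile_chi)
    (fun i => step n * m i) hDu
    fun w hw => (Gam_finDiff_le hu.1 hg hgu s (hs i).ne' w).trans (hS w hw)
  -- `h1` compares the gradients of the approximations with the difference quotients, `h3` the
  -- difference quotients with the weak derivatives. Each costs a factor 2, whence the 4.
  have h3 := (isCoupling_lineMeasure (EuclideanSpace.single i (s i))).abs_ip_sub_ip_le hf hg
    (represents_finDiff hv.1 hf hfv s (hs i).ne') (represents_finDiff hu.1 hg hgu s (hs i).ne')
  have hri : (r i : ℝ) ≤ reach r := by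
    have := Finset.single_le_sum (f := r) (fun _ _ => Nat.zero_le _) (Finset.mem_univ i)
    unfold reach
    exact_mod_cast (by omega : r i ≤ 2 * ∑ i, r i)
  have h4 : osc (lineMeasure (EuclideanSpace.single i (s i))) (weakGrad u i) ≤ oscConst r * S := by
    refine osc_lineMeasure_le hg fun σ h0 h1 => ?_
    refine (Gam_le_of_norm_le_mul hg (reach_pos hd hr) hS ?_).trans
      (mul_le_mul_of_nonneg_right reach_le_oscConst hS0)
    rw [norm_smul, PiLp.norm_single, Real.norm_of_nonneg h0,
      Real.norm_of_nonneg (hs i).le]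
    calc σ * (step n * r i) ≤ 1 * (step n * r i) := mul_le_mul_of_nonneg_right h1 (hs i).le
      _ ≤ reach r * step n := by
        rw [one_mul, mul_comm]
        exact mul_le_mul_of_nonneg_right hri (step_pos n).le
  have h5 := norm2_finDiff_le hv.1 hf hfv s (hs i).ne'
  have h6 : norm2 (finDiff s v i) * osc _ (finDiff s u i) ≤
      norm2 (weakGrad v i) * (oscConst r * S) :=
    mul_le_mul h5 h2 lpNorm_nonneg (norm2_nonneg _)
  have h7 := mul_le_mul_of_nonneg_left h4 (norm2_nonneg (weakGrad v i))
  refine (abs_sub_le _ (ip (finDiff s v i) (finDiff s u i)) _).trans ?_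
  linarith

theorem abs_vecIp_hatApprox_sub_le (hd : 1 ≤ d) (hr : ∀ i, 1 ≤ r i) (m : Fin d → ℤ) (n : ℕ)
    {v u : Space d → ℝ} (hv : MemW12 v) (hu : MemW12 u) {t : Fin d → ℝ}
    (ht : (t = fun i => step n * r i) ∨ (t = fun _ => step n)) :
    |vecIp (weakGrad (hatApprox r m n v)) (weakGrad (hatApprox r m n u)) -
      vecIp (weakGrad v) (weakGrad u)| ≤ 8 * d * oscConst r * (vecNorm2 (weakGrad v) *
        (vecNorm2 (fun i => weakGrad u i - finDiff t u i) +
          ⨆ w : Metric.sphere (0 : Space d) (step n), vecGam w.1 (weakGrad u))) := by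
  set S := vecNorm2 (fun i => weakGrad u i - finDiff t u i) +
    ⨆ w : Metric.sphere (0 : Space d) (step n), vecGam w.1 (weakGrad u)
  have hS : ∀ i, ∀ w : Space d, ‖w‖ ≤ step n → Gam w (weakGrad u i) ≤ 2 * S := by
    intro i w hw
    rcases ht with rfl | rfl
    · exact Gam_weakGrad_le (step_pos n) hu _ r (fun i => hr i) (fun _ => rfl) i hw
    · exact Gam_weakGrad_le (step_pos n) hu _ (fun _ => 1) (fun _ => one_pos) (fun _ => by simp)
        i hw
  have hS0 : 0 ≤ 2 * S :=
    (Gam_nonneg _ _).trans (hS ⟨0, hd⟩ 0 (by simpa using (step_pos n).le))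
  have hC := (oscConst_pos hd hr).le
  rw [vecIp, vecIp, ← Finset.sum_sub_distrib]
  calc _ ≤ ∑ i, |ip (weakGrad (hatApprox r m n v) i) (weakGrad (hatApprox r m n u) i) -
        ip (weakGrad v i) (weakGrad u i)| := Finset.abs_sum_le_sum_abs _ _
    -- The 2 comes from passing from the ball to the sphere; with the 4 and the `d` components this
    -- yields `8 d`.
    _ ≤ ∑ _i : Fin d, 4 * (vecNorm2 (weakGrad v) * (oscConst r * (2 * S))) := by
      refine Finset.sum_le_sum fun i _ => ?_
      refine (abs_ip_weakGrad_hatApprox_sub_le hd hr m n hv hu i (hS i)).trans ?_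
      have := norm2_le_vecNorm2 (weakGrad v) i
      gcongr
    _ = _ := by
      rw [Finset.sum_const, Finset.card_univ, Fintype.card_fin, nsmul_eq_mul]
      ring

end HatApprox

end HatFE

/-! ### The theorem -/

open HatFE
theorem theorem3p2 (d : ℕ) (hd : 1 ≤ d) (r : Fin d → ℕ) (hr : ∀ i, 1 ≤ r i) :
    ∃ c : ℝ, 0 < c ∧ ∀ (n : ℕ) (m : Fin d → ℤ) (v u : Space d → ℝ), MemW12 v → MemW12 u →
      MemW12 (hatApprox r m n v) ∧ MemW12 (hatApprox r m n u) ∧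
      -- the `L_2` products, shifts of length exactly `h`, dimension at least two
      (2 ≤ d →
        |ip (hatApprox r m n v) (hatApprox r m n u) - ip v u| ≤
          c * min (norm2 u * ⨆ w : Metric.sphere (0 : Space d) (step n), Gam w.1 v)
            (norm2 v * ⨆ w : Metric.sphere (0 : Space d) (step n), Gam w.1 u)) ∧
      -- the `L_2` products, shifts of length at most `h`, any dimension
      |ip (hatApprox r m n v) (hatApprox r m n u) - ip v u| ≤
        c * min (norm2 u * ⨆ w : Metric.closedBall (0 : Space d) (step n), Gam w.1 v)
          (norm2 v * ⨆ w : Metric.closedBall (0 : Space d) (step n), Gam w.1 u) ∧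
      -- the products of the gradients, difference quotients with steps `h` or `h r_i`
      ∀ t : Fin d → ℝ, (t = fun i => step n * r i) ∨ (t = fun _ => step n) →
        |vecIp (weakGrad (hatApprox r m n v)) (weakGrad (hatApprox r m n u)) -
            vecIp (weakGrad v) (weakGrad u)| ≤
          c * min
            (vecNorm2 (weakGrad v) *
              (vecNorm2 (fun i => weakGrad u i - finDiff t u i) +
                ⨆ w : Metric.sphere (0 : Space d) (step n), vecGam w.1 (weakGrad u)))
            (vecNorm2 (weakGrad u) *
              (vecNorm2 (fun i => weakGrad v i - finDiff t v i) +
                ⨆ w : Metric.sphere (0 : Space d) (step n), vecGam w.1 (weakGrad v))) := by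
  have hC := oscConst_pos hd hr
  have hd' : (1 : ℝ) ≤ d := by exact_mod_cast hd
  -- The factor `8 d` is dictated by the gradients. The `L²` estimates need only 4 on the sphere and
  -- 2 on the ball, which it absorbs since `d ≥ 1`.
  have hc : 0 < 8 * d * oscConst r := by positivity
  refine ⟨8 * d * oscConst r, hc, fun n m v u hv hu => ⟨memW12_hatApprox hr m n hv.1,
    memW12_hatApprox hr m n hu.1, fun h2 => ?_, ?_, fun t ht => ?_⟩⟩
  · have key : ∀ v u : Space d → ℝ, MemW12 v → MemW12 u →
        |ip (hatApprox r m n v) (hatApprox r m n u) - ip v u| ≤ 8 * d * oscConst r *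
          (norm2 v * ⨆ w : Metric.sphere (0 : Space d) (step n), Gam w.1 u) := by
      intro v u hv hu
      set S := ⨆ w : Metric.sphere (0 : Space d) (step n), Gam w.1 u
      have hS0 : 0 ≤ S := Real.iSup_nonneg fun w => Gam_nonneg _ _
      have h := abs_ip_hatApprox_sub_le hd hr m n hv.1 hu.1 (S := 2 * S) fun w hw =>
        Gam_le_two_mul_of_sphere h2 (step_pos n).le hu.1
          (fun z hz => Gam_le_iSup hu.1 _ (by simpa using hz)) hw
      have h0 : 0 ≤ oscConst r * (norm2 v * S) :=
        mul_nonneg hC.le (mul_nonneg (norm2_nonneg v) hS0)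
      nlinarith
    rw [mul_min_of_nonneg _ _ hc.le]
    refine le_min ?_ (key v u hv hu)
    rw [ip_comm v u, ip_comm (hatApprox r m n v)]
    exact key u v hu hv
  · have key : ∀ v u : Space d → ℝ, MemW12 v → MemW12 u →
        |ip (hatApprox r m n v) (hatApprox r m n u) - ip v u| ≤ 8 * d * oscConst r *
          (norm2 v * ⨆ w : Metric.closedBall (0 : Space d) (step n), Gam w.1 u) := by
      intro v u hv hu
      set S := ⨆ w : Metric.closedBall (0 : Space d) (step n), Gam w.1 u
      have hS0 : 0 ≤ S := Real.iSup_nonneg fun w => Gam_nonneg _ _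
      have h := abs_ip_hatApprox_sub_le hd hr m n hv.1 hu.1 (S := S) fun w hw =>
        Gam_le_iSup hu.1 _ (by simpa using hw)
      have h0 : 0 ≤ oscConst r * (norm2 v * S) :=
        mul_nonneg hC.le (mul_nonneg (norm2_nonneg v) hS0)
      nlinarith
    rw [mul_min_of_nonneg _ _ hc.le]
    refine le_min ?_ (key v u hv hu)
    rw [ip_comm v u, ip_comm (hatApprox r m n v)]
    exact key u v hu hv
  · rw [mul_min_of_nonneg _ _ hc.le]
    refine le_min (abs_vecIp_hatApprox_sub_le hd hr m n hv hu ht) ?_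
    have h := abs_vecIp_hatApprox_sub_le hd hr m n hu hv ht
    simp only [vecIp] at h ⊢
    simp only [ip_comm (weakGrad v _), ip_comm (weakGrad (hatApprox r m n v) _)]
    exact h
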